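/- **Setting.** Let $(C_n)_{n\ge 1}$ be a channel-state Markov chain on $\mathcal C=\{1,\dots,k\}$, $k\ge 1$, with an irreducible, aperiodic, right stochastic transition matrix $\mathbf B$. In state $i$ the transmitted symbol is erased with probability $\varepsilon_i\in[0,1]$, and some $\varepsilon_i<1$; given the channel states, erasures are independent. Fix integers $N\ge 1$ and $0\le K\le N$. Codeword $s\ge 0$ is sent at times $sN+1,\dots,(s+1)N$. Given the channel states and erasures, decoding failures of distinct codewords are independent, and a codeword with $e$ erasures fails to be decoded with probability $P_{\mathrm f}(N-K,e)$, where $$P_{\mathrm f}(p,e)=1-\prod_{l=0}^{e-1}\bigl(1-2^{l-p}\bigr)\ \text{ if } e\le p,\qquad P_{\mathrm f}(p,e)=1\ \text{ if } e>p .$$ Let $D_s\in\{0,1\}$ indicate successful decoding of codeword $s$. For a buffer that initially holds $m$ segments let $Q_0=m$, $Q_{s+1}=(Q_s-D_s)^+$, $H_q=\inf\{s\ge 0: Q_s=q\}$ for $0\le q\le m$, let $T_q=H_{q-1}-H_q$ for $1\le q\le m$ be the sojourn time at level $q$, and put $$Y_m=\frac1m\sum_{q=1}^m T_q=\frac{1}{m}H_0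 .$$ Let $\mathbf K=(\kappa_{ij})$ and $\mathbf M=(\mu_{ij})$, where $\kappa_{ij}$ (resp. $\mu_{ij}$) is the probability, given that $C_1=i$ and $Q_0=1$, that $C_{N+1}=j$ and $Q_1=1$ (resp. $Q_1=0$). Assume that $(\mathbf I-\mathbf K)^{-1}\mathbf M$ is irreducible, meaning that $\mathbf I-\mathbf K$ is invertible and that for all $i,j$ the $(i,j)$ entry of some positive power of this nonnegative matrix is positive. With $T=\inf\{s\ge0: Q_s=0\}$ for the system started at $Q_0=1$, define $$[\mathbf G_T(z)]_{ij}=\mathrm E\bigl[z^T\mathbf 1_{\{C_{NT+1}=j\}}\bigm| C_1=i\bigr]\in[0,\infty],\qquad z>0,$$ and let $\varrho(\mathbf G_T(z))$ be its spectral radius, understood as $+\infty$ if some entry is infinite. **Theorem.** For $x\in\mathbb R$ let $$\Lambda^*(x)=\sup_{\lambda\in\mathbb R}\bigl\{\lambda x-\log\varrho\bigl(\mathbf G_T(e^\lambda)\bigr)\bigr\}\in[-\infty,\infty].$$ Then $\Lambda^*$ is a convex good rate function (it is convex, nonnegative and lower semicontinuous, and its sublevel sets $\{\Lambda^*\le a\}$,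 $a\in\mathbb R$, are compact), and $Y_m$ satisfies the large deviation principle with rate function $\Lambda^*$ for every initial channel state: for every set $\Gamma\subseteq\mathbb R$ and every $c\in\mathcal C$, $$-\inf_{x\in\Gamma^{o}}\Lambda^*(x)\le\liminf_{m\to\infty}\frac1m\log\Pr(Y_m\in\Gamma\mid C_1=c)\le\limsup_{m\to\infty}\frac1m\log\Pr(Y_m\in\Gamma\mid C_1=c)\le-\inf_{x\in\bar\Gamma}\Lambda^*(x),$$ where $\Gamma^{o}$ and $\bar\Gamma$ are the interior and closure of $\Gamma$, $\log 0=-\infty$ and $\inf\emptyset=+\infty$. -/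

import Mathlib

open MeasureTheory Filter Topology
open scoped ENNReal

noncomputable section

namespace ErasureARQ

/-! ### The finite-state erasure channel -/

/-- A finite-state erasure channel with state space `Fin k`: a right stochastic transition matrix
`B`, and in state `i` a symbol is erased with probability `ε i`. -/
structure ErasureChannel (k : ℕ) where
  B : Matrix (Fin k) (Fin k) ℝ
  ε : Fin k → ℝ
  B_stochastic : B ∈ Matrix.rowStochastic ℝ (Fin k)
  ε_mem : ∀ i, ε i ∈ Set.Icc (0 : ℝ) 1

/-- Aperiodicity of a nonnegative matrix: for every state, the return times with positive weight
have greatest common divisor one. -/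
def IsAperiodic {k : ℕ} (B : Matrix (Fin k) (Fin k) ℝ) : Prop :=
  ∀ i : Fin k, ∀ d : ℕ, (∀ n : ℕ, 0 < n → 0 < (B ^ n) i i → d ∣ n) → d = 1

/-- The channel chain is irreducible and aperiodic, and some state has erasure probability less
than one. -/
structure ErasureChannel.IsAdmissible {k : ℕ} (ch : ErasureChannel k) : Prop where
  irreducible : ch.B.IsIrreducible
  aperiodic : IsAperiodic ch.B
  nontrivial : ∃ i, ch.ε i < 1

/-- Probability of decoding failure for a random binary parity check code with `p` parity checks
when `e` erasures have occurred. -/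
def decodingFailure (p e : ℕ) : ℝ :=
  if e ≤ p then 1 - ∏ l ∈ Finset.range e, (1 - (2 : ℝ) ^ ((l : ℤ) - (p : ℤ))) else 1

/-- Number of erasures in codeword `s`, given the erasure pattern `x`. -/
def erasureCount (N : ℕ) (x : ℕ → Bool) (s : ℕ) : ℕ :=
  ((Finset.range N).filter fun l => x (s * N + l) = true).card

/-- One-symbol weight: erasure (or not) of the current symbol in state `i`, then a transition of
the channel to state `j`. -/
def symbolWeight {k : ℕ} (ch : ErasureChannel k) (i : Fin k) (erased : Bool) (j : Fin k) : ℝ :=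
  (if erased then ch.ε i else 1 - ch.ε i) * ch.B i j

/-- Weight of a decoding outcome for a codeword of length `N` carrying `K` information bits that
suffered `e` erasures. -/
def decodingWeight (N K e : ℕ) (success : Bool) : ℝ :=
  if success then 1 - decodingFailure (N - K) e else decodingFailure (N - K) e

/-! ### The ARQ system -/

/-- A realization, on a measurable space `Ω`, of the erasure channel used with codewords of length
`N` carrying `K` information bits. Symbol times start at `0`, and codeword `s` occupies the times
`s * N, …, s * N + N - 1`.

* `C n` is the channel state at time `n`, and `X n` tells whether the symbol sent then is erased;
* `D s` tells whether codeword `s` can be decoded;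
* `P c` is the probability law given that the initial channel state is `c`.

Under `P c`, `C` is a Markov chain started from `c` with transition matrix `B`; given `C`, symbols
are erased independently with the probabilities given by the current states; given all of this,
decoding failures are independent from one codeword to the next, each with the probability
prescribed by the number of erasures in the codeword. The field `law` gives the corresponding
finite-dimensional distributions. -/
structure ARQSystem {k : ℕ} (ch : ErasureChannel k) (N K : ℕ)
    (Ω : Type*) [MeasurableSpace Ω] where
  P : Fin k → Measure Ω
  isProbabilityMeasure : ∀ c, IsProbabilityMeasure (P c)
  C : ℕ → Ω → Fin k
  X : ℕ → Ω → Bool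
  D : ℕ → Ω → Bool
  measurable_C : ∀ n, Measurable (C n)
  measurable_X : ∀ n, Measurable (X n)
  measurable_D : ∀ s, Measurable (D s)
  law : ∀ (c : Fin k) (n : ℕ) (γ : ℕ → Fin k) (x d : ℕ → Bool),
    P c {ω | (∀ l ≤ n * N, C l ω = γ l) ∧ (∀ l < n * N, X l ω = x l) ∧ (∀ s < n, D s ω = d s)}
      = ENNReal.ofReal ((if γ 0 = c then 1 else 0)
          * (∏ l ∈ Finset.range (n * N), symbolWeight ch (γ l) (x l) (γ (l + 1)))
          * ∏ s ∈ Finset.range n, decodingWeight N K (erasureCount N x s) (d s))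

namespace ARQSystem

variable {k : ℕ} {ch : ErasureChannel k} {N K : ℕ} {Ω : Type*} [MeasurableSpace Ω]

/-- The queue length `Q_s` at the onset of codeword `s`, starting from `m` segments:
`Q_{s+1} = (Q_s - D_s)⁺` (truncated subtraction). -/
def queue (S : ARQSystem ch N K Ω) (m : ℕ) : ℕ → Ω → ℕ
  | 0, _ => m
  | s + 1, ω => S.queue m s ω - (if S.D s ω then 1 else 0)

/-- The hitting time `H_q = inf {s ≥ 0 | Q_s = q}` of level `q`, starting from `m` segments
(infinite if level `q` is never reached). -/
def hittingTime (S : ARQSystem ch N K Ω) (m q : ℕ) (ω : Ω) : ℕ∞ :=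
  ⨅ s ∈ {s : ℕ | S.queue m s ω = q}, (s : ℕ∞)

/-- The sojourn time `T_q = H_{q-1} - H_q` at level `q`, for `1 ≤ q ≤ m`, starting from `m`
segments. -/
def sojournTime (S : ARQSystem ch N K Ω) (m q : ℕ) (ω : Ω) : ℕ∞ :=
  S.hittingTime m (q - 1) ω - S.hittingTime m q ω

/-- The empirical mean sojourn time `Y_m = (1/m) ∑_{q=1}^m T_q`, starting from `m` segments. -/
def empiricalMean (S : ARQSystem ch N K Ω) (m : ℕ) (ω : Ω) : ℝ≥0∞ :=
  (∑ q ∈ Finset.Icc 1 m, (S.sojournTime m q ω : ℝ≥0∞)) / m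

/-- The event `Y_m ∈ Γ`, for a set `Γ` of (finite) real numbers. -/
def meanEvent (S : ARQSystem ch N K Ω) (m : ℕ) (Γ : Set ℝ) : Set Ω :=
  {ω | ∃ y ∈ Γ, (y : EReal) = (S.empiricalMean m ω : EReal)}

/-- The sojourn time `T = inf {s ≥ 0 | Q_s = 0}` of the reduced chain, started at level one. -/
def reducedSojournTime (S : ARQSystem ch N K Ω) (ω : Ω) : ℕ∞ := S.hittingTime 1 0 ω

/-- The probability `κ_{ij}` that one codeword transmission takes the channel from `i` to `j`
while the queue stays at level one. -/
def failureMatrix (S : ARQSystem ch N K Ω) : Matrix (Fin k) (Fin k) ℝ :=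
  Matrix.of fun i j => (S.P i).real {ω | S.C N ω = j ∧ S.queue 1 1 ω = 1}

/-- The probability `μ_{ij}` that one codeword transmission takes the channel from `i` to `j`
while the queue goes from level one to level zero. -/
def successMatrix (S : ARQSystem ch N K Ω) : Matrix (Fin k) (Fin k) ℝ :=
  Matrix.of fun i j => (S.P i).real {ω | S.C N ω = j ∧ S.queue 1 1 ω = 0}

/-- The matrix generating function
`[G_T(z)]_{ij} = E [z ^ T * 1_{channel state after T codewords = j} | initial state i]`,
with entries in `[0, ∞]`. -/
def generatingMatrix (S : ARQSystem ch N K Ω) (z : ℝ≥0∞) : Matrix (Fin k) (Fin k) ℝ≥0∞ :=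
  Matrix.of fun i j =>
    ∫⁻ ω, Set.indicator
      {ω | S.reducedSojournTime ω ≠ ⊤ ∧ S.C (N * (S.reducedSojournTime ω).toNat) ω = j}
      (fun ω => z ^ (S.reducedSojournTime ω).toNat) ω ∂(S.P i)

end ARQSystem

/-! ### Spectral radius, rate functions, large deviations -/

open Classical in
/-- Spectral radius of a matrix with entries in `[0, ∞]`: the usual one if all entries are finite,
and `∞` otherwise. -/
def extSpectralRadius {k : ℕ} (A : Matrix (Fin k) (Fin k) ℝ≥0∞) : ℝ≥0∞ :=
  if ∀ i j, A i j ≠ ⊤ then spectralRadius ℂ (A.map fun a => ((a.toReal : ℝ) : ℂ)) else ⊤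

/-- The Fenchel-Legendre transform
`Λ*(x) = sup_{t ∈ ℝ} (t * x - log ϱ(G_T(e^t)))`, with values in the extended reals. -/
def ARQSystem.rateFunction {k : ℕ} {ch : ErasureChannel k} {N K : ℕ} {Ω : Type*}
    [MeasurableSpace Ω] (S : ARQSystem ch N K Ω) (x : ℝ) : EReal :=
  ⨆ t : ℝ, ((t * x : ℝ) : EReal)
    - ENNReal.log (extSpectralRadius (S.generatingMatrix (ENNReal.ofReal (Real.exp t))))

/-- A good rate function on `ℝ`: nonnegative, lower semicontinuous, with compact sublevel sets. -/
structure IsGoodRateFunction (I : ℝ → EReal) : Prop where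
  nonneg : ∀ x, 0 ≤ I x
  lowerSemicontinuous : LowerSemicontinuous I
  isCompact_sublevel : ∀ a : ℝ, IsCompact {x | I x ≤ (a : EReal)}

/-- Convexity of an extended-real-valued function, through its epigraph. -/
def IsConvexFunction (I : ℝ → EReal) : Prop :=
  Convex ℝ {p : ℝ × ℝ | I p.1 ≤ (p.2 : EReal)}

/-- The large deviation principle at speed `m` with rate function `I`, where `prob m Γ` is the
probability that the `m`-th random variable lies in `Γ`; here `log 0 = -∞`, and the infimum over
the empty set is `∞`. -/
def SatisfiesLDP (prob : ℕ → Set ℝ → ℝ≥0∞) (I : ℝ → EReal) : Prop :=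
  ∀ Γ : Set ℝ,
    -(⨅ x ∈ interior Γ, I x)
        ≤ liminf (fun m : ℕ => ((1 / (m : ℝ) : ℝ) : EReal) * ENNReal.log (prob m Γ)) atTop
    ∧ liminf (fun m : ℕ => ((1 / (m : ℝ) : ℝ) : EReal) * ENNReal.log (prob m Γ)) atTop
        ≤ limsup (fun m : ℕ => ((1 / (m : ℝ) : ℝ) : EReal) * ENNReal.log (prob m Γ)) atTop
    ∧ limsup (fun m : ℕ => ((1 / (m : ℝ) : ℝ) : EReal) * ENNReal.log (prob m Γ)) atTop
        ≤ -(⨅ x ∈ closure Γ, I x)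

end ErasureARQ

end

open ErasureARQ

noncomputable section

namespace ErasureARQ

/-! ### Nonnegativity of the weights -/

/-! The proof reduces the problem to powers of a matrix power series. Cutting the law at codeword
boundaries shows that outcomes and boundary states evolve by the block weights `K` (failure) and `M`
(success). The passage down one level then has the series `F = ∑ X^n K^(n-1) M`, `n ≥ 1`, and since
the queue loses at most one segment per codeword, the probability of emptying `m` segments after
exactly `n` codewords, with the channel going from `c` to `j`, is the `(c, j)` entry of the
coefficient of `X^n` in `F^m` (`measure_hittingTime`). Evaluation at `z` is multiplicative and gives
`G_T(z)`, so exponential moments of `H_0` are entries of powers of `G_T(z)`. Write `Λ(t)` for `log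
ϱ(G_T(e^t))`.

Upper bound: Gelfand's formula bounds the row sums of `G_T(z)^m`, Chernoff's inequality bounds each
half-line, and compactness covers the closed set by finitely many of them. A neighbourhood of
infinity is handled by one `t > 0` with `Λ(t)` finite. It exists because invertibility of `I - K`
makes `K^n` decay geometrically (`exists_pow_apply_le_geometric`).

Lower bound: no smoothness or steepness of `Λ` is used. The diagonal coefficients of `F^m` at `c`
are supermultiplicative under convolution, and by irreducibility their exponential growth recovers
the spectral radius (`extSpectralRadius_le_of_diag_le`). If `b + t x < Λ(t)` for all `t`, then each
`t` has a power `m` and a truncation whose generating polynomial exceeds `exp(m (b + t x))`. A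
compactness argument makes one polynomial work for all `t` up to an error `δ t^2`, and minimising
produces a tilt whose mean is nearly `m x` (`exists_tilt`). Cramér's tilting argument for powers of
this single polynomial (`eventually_le_sum_coeff_pow`) gives the bound along multiples of `m`; a
fixed positive mass fills the remainder.

The properties of the rate function come from its being a Legendre transform with `Λ(0) ≤ 0` and `Λ`
below infinity on both sides of zero. -/

lemma decodingFailure_mem_Icc (p e : ℕ) : decodingFailure p e ∈ Set.Icc (0 : ℝ) 1 := by
  unfold decodingFailure
  split_ifs with h
  · have hf : ∀ l ∈ Finset.range e, (1 - (2 : ℝ) ^ ((l : ℤ) - (p : ℤ))) ∈ Set.Icc (0 : ℝ) 1 := by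
      intro l hl
      have hl' := Finset.mem_range.mp hl
      have h1 : (2 : ℝ) ^ ((l : ℤ) - (p : ℤ)) ≤ 1 :=
        zpow_le_one_of_nonpos₀ (by norm_num) (by omega)
      have h2 : (0 : ℝ) < (2 : ℝ) ^ ((l : ℤ) - (p : ℤ)) := by positivity
      exact ⟨by linarith, by linarith⟩
    have h0 := Finset.prod_nonneg fun l hl => (hf l hl).1
    have h1 := Finset.prod_le_one (fun l hl => (hf l hl).1) fun l hl => (hf l hl).2
    exact ⟨by linarith, by linarith⟩
  · exact ⟨zero_le_one, le_rfl⟩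

lemma decodingWeight_nonneg (N K e : ℕ) (d : Bool) : 0 ≤ decodingWeight N K e d := by
  have h := decodingFailure_mem_Icc (N - K) e
  unfold decodingWeight
  split_ifs
  · linarith [h.2]
  · exact h.1

lemma symbolWeight_nonneg {k : ℕ} (ch : ErasureChannel k) (i j : Fin k) (b : Bool) :
    0 ≤ symbolWeight ch i b j := by
  have h := ch.ε_mem i
  unfold symbolWeight
  refine mul_nonneg ?_ (ch.B_stochastic.1 i j)
  split_ifs
  · exact h.1
  · linarith [h.2]

/-! ### Splitting an event along the values of a finite-valued process -/

/-- Extension of a finite tuple to a sequence, constant after the end of the tuple. -/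
def extendTuple {α : Type*} {n : ℕ} (y : Fin n → α) (a : α) (l : ℕ) : α :=
  if h : l < n then y ⟨l, h⟩ else a

/-- Only the process has to be measurable: `A` enters through the restricted measure, so it may be
arbitrary. The padding value `a` is never read, since only indices below `n` are compared. -/
lemma measure_eq_sum_tuple {Ω α : Type*} [MeasurableSpace Ω] [Fintype α] [MeasurableSpace α]
    [MeasurableSingletonClass α] (μ : Measure Ω) {Y : ℕ → Ω → α} (hY : ∀ n, Measurable (Y n))
    (A : Set Ω) (t n : ℕ) (a : α) :
    μ A = ∑ y : Fin n → α, μ (A ∩ {ω | ∀ l < n, Y (t + l) ω = extendTuple y a l}) := by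
  classical
  let f : Ω → (Fin n → α) := fun ω l => Y (t + l) ω
  have hf : Measurable f := measurable_pi_lambda _ fun l => hY _
  have hset : ∀ y : Fin n → α,
      {ω | ∀ l < n, Y (t + l) ω = extendTuple y a l} = f ⁻¹' {y} := by
    intro y
    ext ω
    simp only [Set.mem_ofPred_eq, Set.mem_preimage, Set.mem_singleton_iff, f, funext_iff]
    constructor
    · intro h l
      rw [h l l.2]
      simp [extendTuple]
    · intro h l hl
      simpa [extendTuple, hl] using h ⟨l, hl⟩
  have h := sum_measure_preimage_singleton (μ := μ.restrict A) (f := f) Finset.univ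
    (fun y _ => hf (measurableSet_singleton y))
  simp only [Finset.coe_univ, Set.preimage_univ, Measure.restrict_apply_univ] at h
  rw [← h]
  refine Finset.sum_congr rfl fun y _ => ?_
  rw [hset, Measure.restrict_apply (hf (measurableSet_singleton y)), Set.inter_comm]

namespace ARQSystem

variable {k : ℕ} {ch : ErasureChannel k} {N K : ℕ} {Ω : Type*} [MeasurableSpace Ω]

/-! ### The Markov property at codeword boundaries -/

/-- The event that the first `n` codewords follow the given paths. -/
def cylinder (S : ARQSystem ch N K Ω) (n : ℕ) (γ : ℕ → Fin k) (x d : ℕ → Bool) : Set Ω :=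
  {ω | (∀ l ≤ n * N, S.C l ω = γ l) ∧ (∀ l < n * N, S.X l ω = x l) ∧ (∀ s < n, S.D s ω = d s)}

/-- The product in `law` factors at time `n * N`. The second factor starts in the state where the
first one ends, so its initial indicator equals one. -/
lemma measure_cylinder_succ (S : ARQSystem ch N K Ω) (c : Fin k) (n : ℕ) (γ : ℕ → Fin k)
    (x d : ℕ → Bool) :
    S.P c (S.cylinder (n + 1) γ x d) = S.P c (S.cylinder n γ x d) *
      S.P (γ (n * N)) (S.cylinder 1 (fun l => γ (n * N + l)) (fun l => x (n * N + l))
        (fun s => d (n + s))) := by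
  unfold cylinder
  rw [S.law, S.law, S.law, ← ENNReal.ofReal_mul]
  · congr 1
    rw [add_mul, one_mul, Finset.prod_range_add, Finset.prod_range_succ]
    simp only [one_mul, Finset.prod_range_one, add_zero, if_true, erasureCount, zero_mul,
      ← add_assoc]
    ring
  · refine mul_nonneg (mul_nonneg ?_ ?_) ?_
    · split_ifs <;> norm_num
    · exact Finset.prod_nonneg fun l _ => symbolWeight_nonneg _ _ _ _
    · exact Finset.prod_nonneg fun l _ => decodingWeight_nonneg _ _ _ _

lemma measure_initial_ne (S : ARQSystem ch N K Ω) {c i : Fin k} (h : i ≠ c) :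
    S.P c {ω | S.C 0 ω = i} = 0 := by
  have := S.law c 0 (fun _ => i) (fun _ => false) (fun _ => false)
  simpa [h] using this

/-- The probability that a codeword has decoding outcome `d` and takes the channel from `i`
to `j`. -/
def blockWeight (S : ARQSystem ch N K Ω) (d : Bool) : Matrix (Fin k) (Fin k) ℝ≥0∞ :=
  Matrix.of fun i j => S.P i {ω | S.D 0 ω = d ∧ S.C N ω = j}

/-- The Markov property at a codeword boundary. Both sides are summed over all channel paths and
erasure patterns inside codeword `n`, which reduces the claim to `measure_cylinder_succ`. -/
lemma measure_cylinder_inter (S : ARQSystem ch N K Ω) (c : Fin k) (n : ℕ) (γ : ℕ → Fin k)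
    (x d : ℕ → Bool) (e : Bool) (j : Fin k) :
    S.P c (S.cylinder n γ x d ∩ {ω | S.D n ω = e ∧ S.C ((n + 1) * N) ω = j}) =
      S.P c (S.cylinder n γ x d) * S.blockWeight e (γ (n * N)) j := by
  rw [blockWeight, Matrix.of_apply,
    measure_eq_sum_tuple (S.P c) S.measurable_C _ (n * N) (N + 1) c,
    measure_eq_sum_tuple (S.P (γ (n * N))) S.measurable_C _ 0 (N + 1) c, Finset.mul_sum]
  refine Finset.sum_congr rfl fun g _ => ?_
  rw [measure_eq_sum_tuple (S.P c) S.measurable_X _ (n * N) N false,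
    measure_eq_sum_tuple (S.P (γ (n * N))) S.measurable_X _ 0 N false, Finset.mul_sum]
  refine Finset.sum_congr rfl fun y _ => ?_
  by_cases hj : extendTuple g c N = j
  swap
  · have h1 : ∀ t : Set Ω, ∀ s : Set Ω, (s ∩ {ω | S.D n ω = e ∧ S.C ((n + 1) * N) ω = j}) ∩
        {ω | ∀ l < N + 1, S.C (n * N + l) ω = extendTuple g c l} ∩ t = ∅ := by
      intro t s
      refine Set.eq_empty_of_forall_notMem ?_
      rintro ω ⟨⟨⟨-, -, h⟩, h'⟩, -⟩
      refine hj ?_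
      rw [← h' N (Nat.lt_succ_self N), ← h]
      congr 1
      ring
    have h2 : ∀ t : Set Ω, ({ω | S.D 0 ω = e ∧ S.C N ω = j}) ∩
        {ω | ∀ l < N + 1, S.C (0 + l) ω = extendTuple g c l} ∩ t = ∅ := by
      intro t
      refine Set.eq_empty_of_forall_notMem ?_
      rintro ω ⟨⟨⟨-, h⟩, h'⟩, -⟩
      refine hj ?_
      rw [← h' N (Nat.lt_succ_self N), ← h, zero_add]
    rw [h1, h2]
    simp
  by_cases hi : extendTuple g c 0 = γ (n * N)
  swap
  · have h1 : ∀ t u : Set Ω, (S.cylinder n γ x d ∩ u) ∩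
        {ω | ∀ l < N + 1, S.C (n * N + l) ω = extendTuple g c l} ∩ t = ∅ := by
      intro t u
      refine Set.eq_empty_of_forall_notMem ?_
      rintro ω ⟨⟨⟨h, -⟩, h'⟩, -⟩
      exact hi (by rw [← h' 0 (Nat.succ_pos N), ← h.1 _ le_rfl, add_zero])
    -- For a path with the wrong initial state the event on the left is empty, but the one on the
    -- right is only null.
    have h2 : ∀ t u : Set Ω, S.P (γ (n * N)) (u ∩
        {ω | ∀ l < N + 1, S.C (0 + l) ω = extendTuple g c l} ∩ t) = 0 := by
      intro t u
      refine measure_mono_null ?_ (S.measure_initial_ne hi)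
      rintro ω ⟨⟨-, h'⟩, -⟩
      exact h' 0 (Nat.succ_pos N)
    rw [h1, h2]
    simp
  -- The prescribed past is spliced with the path, pattern and outcome of the new codeword. The two
  -- state paths overlap at `n * N`, where `hi` makes them agree.
  have key := S.measure_cylinder_succ c n
    (fun l => if l ≤ n * N then γ l else extendTuple g c (l - n * N))
    (fun l => if l < n * N then x l else extendTuple y false (l - n * N))
    (fun s => if s < n then d s else e)
  have e1 : S.cylinder n (fun l => if l ≤ n * N then γ l else extendTuple g c (l - n * N))
      (fun l => if l < n * N then x l else extendTuple y false (l - n * N))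
      (fun s => if s < n then d s else e) = S.cylinder n γ x d := by
    ext ω
    simp only [cylinder, Set.mem_ofPred_eq]
    refine and_congr ?_ (and_congr ?_ ?_)
    · exact forall₂_congr fun l hl => by rw [if_pos hl]
    · exact forall₂_congr fun l hl => by rw [if_pos hl]
    · exact forall₂_congr fun l hl => by rw [if_pos hl]
  have hγ : ∀ l, (if n * N + l ≤ n * N then γ (n * N + l)
      else extendTuple g c (n * N + l - n * N)) = extendTuple g c l := by
    intro l
    split_ifs with h
    · have : l = 0 := by omega
      subst this
      simp [hi]
    · simp
  have e2 : S.cylinder (n + 1) (fun l => if l ≤ n * N then γ l else extendTuple g c (l - n * N))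
      (fun l => if l < n * N then x l else extendTuple y false (l - n * N))
      (fun s => if s < n then d s else e) =
      (S.cylinder n γ x d ∩ {ω | S.D n ω = e ∧ S.C ((n + 1) * N) ω = j}) ∩
        {ω | ∀ l < N + 1, S.C (n * N + l) ω = extendTuple g c l} ∩
        {ω | ∀ l < N, S.X (n * N + l) ω = extendTuple y false l} := by
    have hN : (n + 1) * N = n * N + N := by ring
    rw [← e1]
    ext ω
    simp only [cylinder, Set.mem_ofPred_eq, Set.mem_inter_iff]
    constructor
    · rintro ⟨h1, h2, h3⟩
      have h1' : ∀ l < N + 1, S.C (n * N + l) ω = extendTuple g c l := fun l hl => by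
        rw [h1 (n * N + l) (by rw [hN]; omega)]
        exact hγ l
      refine ⟨⟨⟨⟨fun l hl => h1 l (by rw [hN]; omega), fun l hl => h2 l (by rw [hN]; omega),
        fun s hs => h3 s (by omega)⟩, ?_, ?_⟩, h1'⟩, fun l hl => ?_⟩
      · simpa using h3 n (Nat.lt_succ_self n)
      · rw [hN, h1' N (Nat.lt_succ_self N), hj]
      · simpa using h2 (n * N + l) (by rw [hN]; omega)
    · rintro ⟨⟨⟨⟨h1, h2, h3⟩, h4, h5⟩, h6⟩, h7⟩
      refine ⟨fun l hl => ?_, fun l hl => ?_, fun s hs => ?_⟩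
      · rcases le_or_gt l (n * N) with h | h
        · exact h1 l h
        · obtain ⟨a, rfl⟩ := Nat.exists_eq_add_of_lt h
          rw [hN] at hl
          rw [show n * N + a + 1 = n * N + (a + 1) by ring, h6 (a + 1) (by omega)]
          exact (hγ (a + 1)).symm
      · rcases lt_or_ge l (n * N) with h | h
        · exact h2 l h
        · obtain ⟨a, rfl⟩ := Nat.exists_eq_add_of_le h
          rw [hN] at hl
          rw [h7 a (by omega)]
          simp
      · rcases Nat.lt_succ_iff_lt_or_eq.mp hs with h | h
        · exact h3 s h
        · subst h
          simpa using h4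
  rw [e1, e2] at key
  rw [key]
  congr 1
  simp only [le_refl, if_true]
  congr 1
  ext ω
  simp only [hγ]
  simp only [not_lt.mpr (Nat.le_add_right _ _), if_false, Nat.add_sub_cancel_left]
  simp only [cylinder, Set.mem_ofPred_eq, Set.mem_inter_iff, one_mul, zero_add, Nat.lt_one_iff,
    forall_eq, ← Nat.lt_succ_iff (n := N), Nat.succ_eq_add_one]
  constructor
  · rintro ⟨h1, h2, h3⟩
    exact ⟨⟨⟨h3, by rw [h1 N (Nat.lt_succ_self N), hj]⟩, h1⟩, h2⟩
  · rintro ⟨⟨⟨h3, -⟩, h1⟩, h2⟩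
    exact ⟨h1, h2, h3⟩

/-- The probability that the first `n` decoding outcomes are given by `d` and that the channel is
in state `j` after `n` codewords. -/
def prefixWeight (S : ARQSystem ch N K Ω) (c : Fin k) (n : ℕ) (d : ℕ → Bool) (j : Fin k) : ℝ≥0∞ :=
  S.P c {ω | (∀ s < n, S.D s ω = d s) ∧ S.C (n * N) ω = j}

/-- Summing the Markov property over all histories works because the next block weight depends on a
history only through its last state. -/
lemma prefixWeight_succ (S : ARQSystem ch N K Ω) (c : Fin k) (n : ℕ) (d : ℕ → Bool)
    (j : Fin k) :
    S.prefixWeight c (n + 1) d j = ∑ i, S.prefixWeight c n d i * S.blockWeight (d n) i j := by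
  classical
  have hl : ∀ (g : Fin (n * N + 1) → Fin k) (y : Fin (n * N) → Bool) (A : Set Ω),
      (({ω | ∀ s < n, S.D s ω = d s} ∩ A) ∩
        {ω | ∀ l < n * N + 1, S.C (0 + l) ω = extendTuple g c l}) ∩
        {ω | ∀ l < n * N, S.X (0 + l) ω = extendTuple y false l} =
      S.cylinder n (extendTuple g c) (extendTuple y false) d ∩ A := by
    intro g y A
    ext ω
    simp only [cylinder, Set.mem_ofPred_eq, Set.mem_inter_iff, zero_add, Nat.lt_succ_iff]
    tauto
  have hsplit : ∀ A : Set Ω, S.P c ({ω | ∀ s < n, S.D s ω = d s} ∩ A) =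
      ∑ g : Fin (n * N + 1) → Fin k, ∑ y : Fin (n * N) → Bool,
        S.P c (S.cylinder n (extendTuple g c) (extendTuple y false) d ∩ A) := by
    intro A
    rw [measure_eq_sum_tuple (S.P c) S.measurable_C _ 0 (n * N + 1) c]
    refine Finset.sum_congr rfl fun g _ => ?_
    rw [measure_eq_sum_tuple (S.P c) S.measurable_X _ 0 (n * N) false]
    refine Finset.sum_congr rfl fun y _ => ?_
    rw [hl]
  have h1 : S.prefixWeight c (n + 1) d j =
      S.P c ({ω | ∀ s < n, S.D s ω = d s} ∩ {ω | S.D n ω = d n ∧ S.C ((n + 1) * N) ω = j}) := by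
    unfold prefixWeight
    congr 1
    ext ω
    simp only [Set.mem_ofPred_eq, Set.mem_inter_iff, Nat.lt_succ_iff_lt_or_eq, or_imp, forall_and,
      forall_eq, and_assoc]
  have h2 : ∀ i, S.prefixWeight c n d i =
      S.P c ({ω | ∀ s < n, S.D s ω = d s} ∩ {ω | S.C (n * N) ω = i}) := fun i => rfl
  simp only [h1, h2, hsplit, Finset.sum_mul]
  refine Eq.trans (Finset.sum_congr rfl fun g _ => ?_) Finset.sum_comm
  refine Eq.trans ?_ Finset.sum_comm
  refine Finset.sum_congr rfl fun y _ => ?_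
  -- The history fixes the state at time `n * N`, so only one `i` contributes.
  rw [measure_cylinder_inter, Finset.sum_eq_single (extendTuple g c (n * N))]
  · congr 2
    exact (Set.inter_eq_left.mpr fun ω hω => hω.1 _ le_rfl).symm
  · intro i _ hi
    rw [show S.cylinder n (extendTuple g c) (extendTuple y false) d ∩ {ω | S.C (n * N) ω = i} = ∅
      from Set.eq_empty_of_forall_notMem fun ω hω => hi (hω.2.symm.trans (hω.1.1 _ le_rfl))]
    simp
  · simp

lemma prefixWeight_zero (S : ARQSystem ch N K Ω) (c : Fin k) (d : ℕ → Bool) (j : Fin k) :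
    S.prefixWeight c 0 d j = if j = c then 1 else 0 := by
  have := S.law c 0 (fun _ => j) (fun _ => false) (fun _ => false)
  have h : S.P c {ω | S.C 0 ω = j} = ENNReal.ofReal (if j = c then 1 else 0) := by
    simpa using this
  simp only [prefixWeight, Nat.not_lt_zero, false_imp_iff, implies_true, true_and, zero_mul, h]
  split_ifs <;> simp

end ARQSystem

/-! ### First passage -/

/-- The queue length after `s` codewords with outcomes `d`, starting from `m`. -/
def drain (d : ℕ → Bool) (m : ℕ) : ℕ → ℕ
  | 0 => m
  | s + 1 => drain d m s - (if d s then 1 else 0)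

lemma drain_succ' (d : ℕ → Bool) (m s : ℕ) :
    drain d m (s + 1) = drain (fun l => d (l + 1)) (m - (if d 0 then 1 else 0)) s := by
  induction s with
  | zero => rfl
  | succ s ih => rw [drain, ih]; rfl

/-- The queue, starting from `m` segments, empties exactly after `n` codewords. -/
def HitsAt : ℕ → ℕ → (ℕ → Bool) → Prop
  | 0, m, _ => m = 0
  | _ + 1, 0, _ => False
  | n + 1, m + 1, d =>
      if d 0 then HitsAt n m (fun l => d (l + 1)) else HitsAt n (m + 1) (fun l => d (l + 1))

lemma hitsAt_iff (n m : ℕ) (d : ℕ → Bool) :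
    HitsAt n m d ↔ drain d m n = 0 ∧ ∀ s < n, drain d m s ≠ 0 := by
  induction n generalizing m d with
  | zero => simp [HitsAt, drain]
  | succ n ih =>
    cases m with
    | zero =>
      simp only [HitsAt, false_iff, not_and, not_forall]
      exact fun _ => ⟨0, Nat.succ_pos n, by simp [drain]⟩
    | succ m =>
      have hall : (∀ s < n + 1, drain d (m + 1) s ≠ 0) ↔
          ∀ s < n, drain d (m + 1) (s + 1) ≠ 0 := by
        constructor
        · exact fun h s hs => h (s + 1) (by omega)
        · intro h s hs
          cases s with
          | zero => simp [drain]
          | succ s => exact h s (by omega)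
      rw [hall]
      simp only [drain_succ', HitsAt]
      cases d 0 <;> simp [ih]

/-- The power series with coefficients `K ^ (n - 1) * M`, `n ≥ 1`. -/
def passageSeries {σ R : Type*} [Fintype σ] [DecidableEq σ] [Semiring R] (A M : Matrix σ σ R) :
    PowerSeries (Matrix σ σ R) :=
  PowerSeries.mk fun n => if n = 0 then 0 else A ^ (n - 1) * M

section Series

variable {σ R : Type*} [Fintype σ] [DecidableEq σ] [Semiring R] (A M : Matrix σ σ R)

lemma coeff_passageSeries_zero : PowerSeries.coeff 0 (passageSeries A M) = 0 := by
  simp [passageSeries]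

lemma coeff_passageSeries_succ (n : ℕ) :
    PowerSeries.coeff (n + 1) (passageSeries A M) = A ^ n * M := by
  simp [passageSeries]

/-- First-step analysis: one codeword is spent (`X`), then either it fails and the passage starts
afresh, or it succeeds and the passage ends. -/
lemma passageSeries_eq : passageSeries A M =
    PowerSeries.X * (PowerSeries.C A * passageSeries A M + PowerSeries.C M) := by
  ext1 n
  cases n with
  | zero => simp [coeff_passageSeries_zero]
  | succ n =>
    rw [coeff_passageSeries_succ, PowerSeries.coeff_succ_X_mul, map_add, PowerSeries.coeff_C_mul,
      PowerSeries.coeff_C]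
    cases n with
    | zero => simp [coeff_passageSeries_zero]
    | succ n => simp [coeff_passageSeries_succ, pow_succ', mul_assoc]

/-- The first-step equation is applied to the leftmost factor, since matrices do not commute. The
outcome is the recursion that defines `HitsAt`. -/
lemma coeff_succ_passageSeries_pow_succ (n q : ℕ) :
    PowerSeries.coeff (n + 1) (passageSeries A M ^ (q + 1)) =
      A * PowerSeries.coeff n (passageSeries A M ^ (q + 1)) +
        M * PowerSeries.coeff n (passageSeries A M ^ q) := by
  have h := congrArg (· * passageSeries A M ^ q) (passageSeries_eq A M)
  simp only [← pow_succ'] at h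
  conv_lhs => rw [h]
  rw [mul_assoc, PowerSeries.coeff_succ_X_mul, add_mul, map_add, mul_assoc, ← pow_succ',
    PowerSeries.coeff_C_mul, PowerSeries.coeff_C_mul]

lemma coeff_zero_passageSeries_pow_succ (q : ℕ) :
    PowerSeries.coeff 0 (passageSeries A M ^ (q + 1)) = 0 := by
  rw [pow_succ', passageSeries_eq, mul_assoc, PowerSeries.coeff_zero_X_mul]

end Series

/-! ### The law of the emptying time -/

namespace ARQSystem

variable {k : ℕ} {ch : ErasureChannel k} {N K : ℕ} {Ω : Type*} [MeasurableSpace Ω]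

/-- The matrix power series whose `n`-th coefficient contains the probabilities that the sojourn
at one level takes `n` codewords and leads from one channel state to another. -/
def sojournSeries (S : ARQSystem ch N K Ω) : PowerSeries (Matrix (Fin k) (Fin k) ℝ≥0∞) :=
  passageSeries (S.blockWeight false) (S.blockWeight true)

/-- The prefix is carried along because `law` describes paths from time zero only. The induction
absorbs the outcome of codeword `t` into the prefix, matching one step of `HitsAt` with one step of
the coefficient recursion. -/
lemma measure_prefix_hitsAt (S : ARQSystem ch N K Ω) (c : Fin k) (n : ℕ) (t q : ℕ)
    (d : ℕ → Bool) (j : Fin k) :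
    S.P c {ω | (∀ s < t, S.D s ω = d s) ∧ HitsAt n q (fun l => S.D (t + l) ω) ∧
      S.C ((t + n) * N) ω = j} =
      ∑ i, S.prefixWeight c t d i * PowerSeries.coeff n (S.sojournSeries ^ q) i j := by
  induction n generalizing t q d with
  | zero =>
    cases q with
    | zero => simp [HitsAt, prefixWeight, Matrix.one_apply]
    | succ q =>
      rw [sojournSeries, coeff_zero_passageSeries_pow_succ]
      simp [HitsAt]
  | succ n ih =>
    cases q with
    | zero => simp [HitsAt, PowerSeries.coeff_one]
    | succ q =>
      have hp : ∀ e : Bool, S.prefixWeight c t (Function.update d t e) = S.prefixWeight c t d := by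
        intro e
        ext i
        unfold prefixWeight
        congr 1
        ext ω
        simp only [Set.mem_ofPred_eq]
        refine and_congr_left' (forall₂_congr fun s hs => ?_)
        rw [Function.update_of_ne hs.ne]
      have hset : ∀ e : Bool, {ω | (∀ s < t, S.D s ω = d s) ∧
          HitsAt (n + 1) (q + 1) (fun l => S.D (t + l) ω) ∧ S.C ((t + (n + 1)) * N) ω = j} ∩
          {ω | S.D t ω = e} = {ω | (∀ s < t + 1, S.D s ω = Function.update d t e s) ∧
          HitsAt n (if e then q else q + 1) (fun l => S.D (t + 1 + l) ω) ∧
            S.C ((t + 1 + n) * N) ω = j} := by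
        intro e
        ext ω
        have h1 : (∀ s < t + 1, S.D s ω = Function.update d t e s) ↔
            (∀ s < t, S.D s ω = d s) ∧ S.D t ω = e := by
          constructor
          · intro h
            refine ⟨fun s hs => ?_, by simpa using h t (Nat.lt_succ_self t)⟩
            rw [h s (by omega), Function.update_of_ne hs.ne]
          · rintro ⟨h, h'⟩ s hs
            rcases Nat.lt_succ_iff_lt_or_eq.mp hs with hs | rfl
            · rw [h s hs, Function.update_of_ne hs.ne]
            · simpa using h'
        simp only [Set.mem_ofPred_eq, Set.mem_inter_iff, h1, HitsAt, add_zero,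
          add_assoc, add_comm 1]
        constructor
        · rintro ⟨⟨h2, h3, h4⟩, h5⟩
          rw [h5] at h3
          refine ⟨⟨h2, h5⟩, ?_, h4⟩
          split_ifs at h3 ⊢ <;> exact h3
        · rintro ⟨⟨h2, h5⟩, h3, h4⟩
          rw [h5]
          refine ⟨⟨h2, ?_, h4⟩, rfl⟩
          split_ifs at h3 ⊢ <;> exact h3
      have hdiff : ∀ A : Set Ω, A \ {ω | S.D t ω = true} = A ∩ {ω | S.D t ω = false} := by
        intro A
        ext ω
        simp
      have hmeas : MeasurableSet {ω | S.D t ω = true} :=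
        S.measurable_D t (measurableSet_singleton true)
      rw [← measure_inter_add_sdiff _ hmeas, hdiff, hset, hset, ih, ih, sojournSeries,
        coeff_succ_passageSeries_pow_succ]
      simp only [prefixWeight_succ, hp, Function.update_self, if_true, Bool.false_eq_true, if_false,
        Matrix.add_apply, Matrix.mul_apply, mul_add, Finset.sum_add_distrib, Finset.sum_mul,
        Finset.mul_sum]
      rw [add_comm]
      congr 1 <;>
      · rw [Finset.sum_comm]
        simp only [mul_assoc]

lemma queue_eq_drain (S : ARQSystem ch N K Ω) (m s : ℕ) (ω : Ω) :
    S.queue m s ω = drain (fun l => S.D l ω) m s := by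
  induction s with
  | zero => rfl
  | succ s ih => rw [queue, drain, ih]

lemma hittingTime_eq_natCast_iff (S : ARQSystem ch N K Ω) (m q n : ℕ) (ω : Ω) :
    S.hittingTime m q ω = n ↔ S.queue m n ω = q ∧ ∀ s < n, S.queue m s ω ≠ q := by
  unfold hittingTime
  constructor
  · intro h
    have hlow : ∀ s < n, S.queue m s ω ≠ q := by
      intro s hs hq
      have : (n : ℕ∞) ≤ s := h ▸ iInf₂_le s hq
      exact absurd (Nat.cast_le.mp this) (by omega)
    refine ⟨?_, hlow⟩
    by_contra hn
    have : ((n + 1 : ℕ) : ℕ∞) ≤ n := by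
      rw [← h]
      refine le_iInf₂ fun s hs => Nat.cast_le.mpr ?_
      rcases lt_trichotomy s n with h' | h' | h'
      · exact absurd hs (hlow s h')
      · subst h'; exact absurd hs hn
      · exact h'
    exact absurd (Nat.cast_le.mp this) (by omega)
  · rintro ⟨h1, h2⟩
    refine le_antisymm (iInf₂_le n h1) (le_iInf₂ fun s hs => Nat.cast_le.mpr ?_)
    by_contra h
    exact h2 s (by omega) hs

lemma hittingTime_zero_eq_iff (S : ARQSystem ch N K Ω) (m n : ℕ) (ω : Ω) :
    S.hittingTime m 0 ω = n ↔ HitsAt n m (fun l => S.D l ω) := by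
  rw [hittingTime_eq_natCast_iff, hitsAt_iff]
  simp only [queue_eq_drain]

lemma measure_hittingTime (S : ARQSystem ch N K Ω) (c : Fin k) (m n : ℕ) (j : Fin k) :
    S.P c {ω | S.hittingTime m 0 ω = n ∧ S.C (n * N) ω = j} =
      PowerSeries.coeff n (S.sojournSeries ^ m) c j := by
  have h := S.measure_prefix_hitsAt c n 0 m (fun _ => false) j
  simp only [prefixWeight_zero, Nat.not_lt_zero, false_imp_iff, implies_true, true_and,
    zero_add, ite_mul, one_mul, zero_mul, Finset.sum_ite_eq', Finset.mem_univ, if_true] at h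
  simpa only [hittingTime_zero_eq_iff] using h

lemma measurable_queue (S : ARQSystem ch N K Ω) (m s : ℕ) : Measurable (S.queue m s) := by
  induction s with
  | zero => exact measurable_const
  | succ s ih =>
    have : S.queue m (s + 1) = fun ω => S.queue m s ω - (if S.D s ω = true then 1 else 0) := rfl
    rw [this]
    exact ih.sub (Measurable.ite (S.measurable_D s (measurableSet_singleton true))
      measurable_const measurable_const)

lemma measurableSet_hittingTime_eq (S : ARQSystem ch N K Ω) (m q n : ℕ) :
    MeasurableSet {ω | S.hittingTime m q ω = n} := by
  simp only [hittingTime_eq_natCast_iff]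
  have : {ω | S.queue m n ω = q ∧ ∀ s < n, S.queue m s ω ≠ q} =
      {ω | S.queue m n ω = q} ∩ ⋂ s, ⋂ (_ : s < n), {ω | S.queue m s ω = q}ᶜ := by
    ext ω
    simp
  rw [this]
  exact (S.measurable_queue m n (measurableSet_singleton q)).inter
    (MeasurableSet.iInter fun s => MeasurableSet.iInter fun _ =>
      (S.measurable_queue m s (measurableSet_singleton q)).compl)

lemma measurableSet_hittingTime_state (S : ARQSystem ch N K Ω) (m n l : ℕ) (j : Fin k) :
    MeasurableSet {ω | S.hittingTime m 0 ω = n ∧ S.C l ω = j} :=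
  (S.measurableSet_hittingTime_eq m 0 n).inter (S.measurable_C l (measurableSet_singleton j))

lemma sum_measure_inter_state (S : ARQSystem ch N K Ω) (c : Fin k) (A : Set Ω) (l : ℕ) :
    ∑ j, S.P c (A ∩ {ω | S.C l ω = j}) = S.P c A := by
  have h := sum_measure_preimage_singleton (μ := (S.P c).restrict A) (f := S.C l) Finset.univ
    (fun y _ => S.measurable_C l (measurableSet_singleton y))
  simp only [Finset.coe_univ, Set.preimage_univ, Measure.restrict_apply_univ] at h
  rw [← h]
  refine Finset.sum_congr rfl fun j _ => ?_
  rw [Measure.restrict_apply (S.measurable_C l (measurableSet_singleton j)), Set.inter_comm]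
  rfl

lemma measure_hittingTime_eq (S : ARQSystem ch N K Ω) (c : Fin k) (m n : ℕ) :
    S.P c {ω | S.hittingTime m 0 ω = n} =
      ∑ j, PowerSeries.coeff n (S.sojournSeries ^ m) c j := by
  simp only [← measure_hittingTime]
  exact (S.sum_measure_inter_state c _ (n * N)).symm

/-! ### The empirical mean sojourn time -/

lemma exists_le_queue_eq_succ (S : ARQSystem ch N K Ω) {m q s : ℕ} {ω : Ω} (hq : q < m)
    (h : S.queue m s ω = q) : ∃ t ≤ s, S.queue m t ω = q + 1 := by
  induction s with
  | zero => exact absurd h (by simp only [queue]; omega)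
  | succ s ih =>
    by_cases h' : S.queue m s ω = q
    · obtain ⟨t, ht, h''⟩ := ih h'
      exact ⟨t, by omega, h''⟩
    · refine ⟨s, by omega, ?_⟩
      simp only [queue] at h
      split_ifs at h <;> omega

lemma hittingTime_succ_le (S : ARQSystem ch N K Ω) {m q : ℕ} (hq : q < m) (ω : Ω) :
    S.hittingTime m (q + 1) ω ≤ S.hittingTime m q ω := by
  refine le_iInf₂ fun s hs => ?_
  obtain ⟨t, ht, h⟩ := S.exists_le_queue_eq_succ hq hs
  exact (iInf₂_le t h).trans (Nat.cast_le.mpr ht)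

/-- The queue drops by at most one, so levels are visited in decreasing order and the sum
telescopes. Truncated subtraction in `ℕ∞` is harmless, also at infinity, because the hitting times
are monotone. -/
lemma sum_sojournTime (S : ARQSystem ch N K Ω) (m : ℕ) (ω : Ω) :
    ∑ q ∈ Finset.Icc 1 m, S.sojournTime m q ω = S.hittingTime m 0 ω := by
  have h : ∀ l ≤ m, ∑ q ∈ Finset.Icc 1 l, S.sojournTime m q ω + S.hittingTime m l ω =
      S.hittingTime m 0 ω := by
    intro l
    induction l with
    | zero => simp
    | succ l ih =>
      intro hl
      rw [Finset.sum_Icc_succ_top (by omega), add_assoc, sojournTime, Nat.add_sub_cancel,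
        tsub_add_cancel_of_le (S.hittingTime_succ_le (by omega) ω), ih (by omega)]
  have hm : S.hittingTime m m ω = 0 := by
    have := (S.hittingTime_eq_natCast_iff m m 0 ω).mpr ⟨rfl, by simp⟩
    simpa using this
  simpa [hm] using h m le_rfl

lemma empiricalMean_eq (S : ARQSystem ch N K Ω) (m : ℕ) (ω : Ω) :
    S.empiricalMean m ω = (S.hittingTime m 0 ω : ℝ≥0∞) / m := by
  rw [empiricalMean, ← sum_sojournTime]
  congr 1
  exact (map_sum ENat.toENNRealRingHom _ _).symm

/-- An infinite emptying time gives an infinite mean, which belongs to no set of reals; hence only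
finite values `n` occur. -/
lemma meanEvent_eq (S : ARQSystem ch N K Ω) {m : ℕ} (hm : 0 < m) (Γ : Set ℝ) :
    S.meanEvent m Γ = ⋃ n : ℕ, {ω | S.hittingTime m 0 ω = n ∧ (n / m : ℝ) ∈ Γ} := by
  have hm' : (m : ℝ≥0∞) ≠ 0 := by exact_mod_cast hm.ne'
  have hfin : ∀ n : ℕ, ((((n : ℝ≥0∞) / m : ℝ≥0∞)) : EReal) = ((n / m : ℝ) : EReal) := by
    intro n
    rw [← EReal.coe_ennreal_toReal (ENNReal.div_ne_top (by simp) hm'), ENNReal.toReal_div]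
    simp
  ext ω
  simp only [meanEvent, empiricalMean_eq, Set.mem_ofPred_eq, Set.mem_iUnion]
  constructor
  · rintro ⟨y, hy, h⟩
    have htop : S.hittingTime m 0 ω ≠ ⊤ := by
      intro htop
      rw [htop, ENat.toENNReal_top, ENNReal.top_div_of_ne_top (by simp)] at h
      simp at h
    obtain ⟨n, hn⟩ := ENat.ne_top_iff_exists.mp htop
    refine ⟨n, hn.symm, ?_⟩
    rw [← hn, ENat.toENNReal_coe, hfin, EReal.coe_eq_coe_iff] at h
    rwa [← h]
  · rintro ⟨n, hn, hΓ⟩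
    refine ⟨_, hΓ, ?_⟩
    rw [hn, ENat.toENNReal_coe, hfin]

open Classical in
lemma measure_meanEvent (S : ARQSystem ch N K Ω) (c : Fin k) {m : ℕ} (hm : 0 < m) (Γ : Set ℝ) :
    S.P c (S.meanEvent m Γ) = ∑' n : ℕ, if (n / m : ℝ) ∈ Γ then
      ∑ j, PowerSeries.coeff n (S.sojournSeries ^ m) c j else 0 := by
  rw [S.meanEvent_eq hm, measure_iUnion]
  · refine tsum_congr fun n => ?_
    split_ifs with h
    · simp [h, measure_hittingTime_eq]
    · simp [h]
  · intro n n' hne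
    refine Set.disjoint_left.mpr ?_
    rintro ω ⟨h, -⟩ ⟨h', -⟩
    exact hne (by rw [h] at h'; exact_mod_cast h')
  · intro n
    exact (S.measurableSet_hittingTime_eq m 0 n).inter (MeasurableSet.const _)

/-! ### The matrix generating function -/

/-- The integrand is split according to the value of `T`; where `T` is infinite, every term
vanishes. -/
lemma generatingMatrix_apply (S : ARQSystem ch N K Ω) (z : ℝ≥0∞) (i j : Fin k) :
    S.generatingMatrix z i j = ∑' n : ℕ, z ^ n * PowerSeries.coeff n S.sojournSeries i j := by
  rw [generatingMatrix, Matrix.of_apply]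
  have h : ∀ ω, Set.indicator
      {ω | S.reducedSojournTime ω ≠ ⊤ ∧ S.C (N * (S.reducedSojournTime ω).toNat) ω = j}
      (fun ω => z ^ (S.reducedSojournTime ω).toNat) ω =
      ∑' n : ℕ, Set.indicator {ω | S.hittingTime 1 0 ω = n ∧ S.C (n * N) ω = j}
        (fun _ => z ^ n) ω := by
    intro ω
    by_cases htop : S.hittingTime 1 0 ω = ⊤
    · simp [reducedSojournTime, htop]
    · obtain ⟨n, hn⟩ := ENat.ne_top_iff_exists.mp htop
      rw [tsum_eq_single n]
      · simp [reducedSojournTime, ← hn, Set.indicator_apply, mul_comm]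
      · intro n' hne
        refine Set.indicator_of_notMem ?_ _
        rintro ⟨h, -⟩
        rw [← hn] at h
        exact hne (by exact_mod_cast h.symm)
  simp only [h]
  rw [lintegral_tsum fun n => (measurable_const.indicator
    (S.measurableSet_hittingTime_state 1 n _ j)).aemeasurable]
  refine tsum_congr fun n => ?_
  rw [lintegral_indicator_const (S.measurableSet_hittingTime_state 1 n _ j),
    measure_hittingTime, pow_one]

lemma failureMatrix_apply (S : ARQSystem ch N K Ω) (i j : Fin k) :
    S.failureMatrix i j = (S.blockWeight false i j).toReal := by
  rw [failureMatrix, blockWeight, Matrix.of_apply, Matrix.of_apply, Measure.real]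
  congr 2
  ext ω
  simp only [queue, Set.mem_ofPred_eq]
  cases S.D 0 ω <;> simp

lemma successMatrix_apply (S : ARQSystem ch N K Ω) (i j : Fin k) :
    S.successMatrix i j = (S.blockWeight true i j).toReal := by
  rw [successMatrix, blockWeight, Matrix.of_apply, Matrix.of_apply, Measure.real]
  congr 2
  ext ω
  simp only [queue, Set.mem_ofPred_eq]
  cases S.D 0 ω <;> simp

end ARQSystem

/-! ### Evaluation of matrix power series with entries in `[0, ∞]` -/

/-- The value at `z` of a power series with matrix coefficients. -/
def evalSeries {σ : Type*} (F : PowerSeries (Matrix σ σ ℝ≥0∞)) [Fintype σ] [DecidableEq σ]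
    (z : ℝ≥0∞) : Matrix σ σ ℝ≥0∞ :=
  Matrix.of fun i j => ∑' n : ℕ, z ^ n * PowerSeries.coeff n F i j

section Eval

variable {σ : Type*} [Fintype σ] [DecidableEq σ] (F G : PowerSeries (Matrix σ σ ℝ≥0∞)) (z : ℝ≥0∞)

lemma evalSeries_apply (i j : σ) :
    evalSeries F z i j = ∑' n : ℕ, z ^ n * PowerSeries.coeff n F i j := rfl

lemma evalSeries_one : evalSeries (1 : PowerSeries (Matrix σ σ ℝ≥0∞)) z = 1 := by
  ext i j
  rw [evalSeries_apply, tsum_eq_single 0]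
  · simp
  · intro n hn
    simp [PowerSeries.coeff_one, hn]

/-- The Cauchy product. With entries in `[0, ∞]` the rearrangement needs no convergence assumption,
so it also holds where the generating matrix is infinite. -/
lemma evalSeries_mul : evalSeries (F * G) z = evalSeries F z * evalSeries G z := by
  ext i j
  simp only [Matrix.mul_apply, evalSeries_apply]
  have h1 : ∀ l, (∑' n : ℕ, z ^ n * PowerSeries.coeff n F i l) *
      (∑' n : ℕ, z ^ n * PowerSeries.coeff n G l j) =
      ∑' p : ℕ × ℕ, (z ^ p.1 * PowerSeries.coeff p.1 F i l) *
        (z ^ p.2 * PowerSeries.coeff p.2 G l j) := by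
    intro l
    rw [ENNReal.tsum_prod', ← ENNReal.tsum_mul_right]
    exact tsum_congr fun a => ENNReal.tsum_mul_left.symm
  simp only [h1]
  rw [← Summable.tsum_finsetSum fun _ _ => ENNReal.summable,
    ← Equiv.tsum_eq (Finset.HasAntidiagonal.sigmaAntidiagonalEquivProd (A := ℕ)),
    ENNReal.tsum_sigma']
  refine tsum_congr fun n => ?_
  rw [tsum_fintype, PowerSeries.coeff_mul, Matrix.sum_apply, Finset.mul_sum,
    ← Finset.sum_coe_sort (Finset.HasAntidiagonal.antidiagonal n)]
  refine Finset.sum_congr rfl fun p _ => ?_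
  have hp : p.1.1 + p.1.2 = n := Finset.HasAntidiagonal.mem_antidiagonal.mp p.2
  simp only [Finset.HasAntidiagonal.sigmaAntidiagonalEquivProd_apply, Matrix.mul_apply,
    Finset.mul_sum]
  refine Finset.sum_congr rfl fun l _ => ?_
  have hz : z ^ n = z ^ p.1.1 * z ^ p.1.2 := by rw [← pow_add, hp]
  rw [hz]
  ring

lemma evalSeries_pow (m : ℕ) : evalSeries (F ^ m) z = evalSeries F z ^ m := by
  induction m with
  | zero => rw [pow_zero, pow_zero, evalSeries_one]
  | succ m ih => rw [pow_succ, pow_succ, evalSeries_mul, ih]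

end Eval

/-! ### Matrices with entries in `[0, ∞]` -/

section Matrix

lemma mul_apply_le_mul_apply {σ : Type*} [Fintype σ] (A B : Matrix σ σ ℝ≥0∞) (i l j : σ) :
    A i l * B l j ≤ (A * B) i j := by
  rw [Matrix.mul_apply]
  exact Finset.single_le_sum (f := fun l => A i l * B l j) (fun _ _ => zero_le)
    (Finset.mem_univ l)

variable {σ : Type*} [Fintype σ] [DecidableEq σ]

lemma rowSum_pow_le_one {A : Matrix σ σ ℝ≥0∞} (hA : ∀ i, ∑ j, A i j ≤ 1) (m : ℕ) (i : σ) :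
    ∑ j, (A ^ m) i j ≤ 1 := by
  induction m generalizing i with
  | zero => simp [Matrix.one_apply]
  | succ m ih =>
    simp only [pow_succ', Matrix.mul_apply]
    rw [Finset.sum_comm]
    simp only [← Finset.mul_sum]
    exact (Finset.sum_le_sum fun l _ => mul_le_of_le_one_right' (ih l)).trans (hA i)

/-- The complex matrix with the same entries, infinite ones being replaced by zero. -/
def toComplexMatrix {τ : Type*} (A : Matrix τ τ ℝ≥0∞) : Matrix τ τ ℂ :=
  A.map fun a => ((a.toReal : ℝ) : ℂ)

lemma pow_apply_ne_top {A : Matrix σ σ ℝ≥0∞} (hA : ∀ i j, A i j ≠ ⊤) (m : ℕ) (i j : σ) :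
    (A ^ m) i j ≠ ⊤ := by
  induction m generalizing i j with
  | zero => rw [pow_zero, Matrix.one_apply]; split_ifs <;> simp
  | succ m ih =>
    rw [pow_succ, Matrix.mul_apply]
    exact ENNReal.sum_ne_top.mpr fun l _ => ENNReal.mul_ne_top (ih _ _) (hA _ _)

lemma toComplexMatrix_pow {A : Matrix σ σ ℝ≥0∞} (hA : ∀ i j, A i j ≠ ⊤) (m : ℕ) :
    toComplexMatrix (A ^ m) = toComplexMatrix A ^ m := by
  induction m with
  | zero =>
    ext i j
    simp only [toComplexMatrix, pow_zero, Matrix.map_apply, Matrix.one_apply]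
    split_ifs <;> simp
  | succ m ih =>
    rw [pow_succ, pow_succ, ← ih]
    ext i j
    simp only [toComplexMatrix, Matrix.map_apply, Matrix.mul_apply]
    rw [ENNReal.toReal_sum fun l _ => ENNReal.mul_ne_top (pow_apply_ne_top hA _ _ _) (hA _ _)]
    push_cast
    simp

attribute [local instance] Matrix.linftyOpNormedRing Matrix.linftyOpNormedAlgebra
  Matrix.linfty_opNormOneClass

lemma nnnorm_toComplexMatrix_apply {τ : Type*} {A : Matrix τ τ ℝ≥0∞}
    (hA : ∀ i j, A i j ≠ ⊤) (i j : τ) :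
    ((‖toComplexMatrix A i j‖₊ : NNReal) : ℝ≥0∞) = A i j := by
  have h : ‖toComplexMatrix A i j‖₊ = (A i j).toNNReal := by
    ext
    simp [toComplexMatrix, ENNReal.coe_toNNReal_eq_toReal]
  rw [h, ENNReal.coe_toNNReal (hA i j)]

lemma rowSum_le_nnnorm {A : Matrix σ σ ℝ≥0∞} (hA : ∀ i j, A i j ≠ ⊤) (i : σ) :
    ∑ j, A i j ≤ (‖toComplexMatrix A‖₊ : NNReal) := by
  simp only [← nnnorm_toComplexMatrix_apply hA]
  rw [Matrix.linfty_opNNNorm_def, ← ENNReal.ofNNReal_finsetSum, ENNReal.coe_le_coe]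
  exact Finset.le_sup (f := fun i => ∑ j, ‖toComplexMatrix A i j‖₊) (Finset.mem_univ i)

lemma nnnorm_le_of_rowSum_le {A : Matrix σ σ ℝ≥0∞} (hA : ∀ i j, A i j ≠ ⊤) {C : ℝ≥0∞}
    (h : ∀ i, ∑ j, A i j ≤ C) : ((‖toComplexMatrix A‖₊ : NNReal) : ℝ≥0∞) ≤ C := by
  rcases eq_or_ne C ⊤ with rfl | hC
  · exact le_top
  lift C to NNReal using hC
  rw [ENNReal.coe_le_coe, Matrix.linfty_opNNNorm_def]
  refine Finset.sup_le fun i _ => ?_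
  rw [← ENNReal.coe_le_coe, ENNReal.ofNNReal_finsetSum]
  simpa only [nnnorm_toComplexMatrix_apply hA] using h i

variable {k : ℕ}

lemma extSpectralRadius_of_ne_top {A : Matrix (Fin k) (Fin k) ℝ≥0∞} (hA : ∀ i j, A i j ≠ ⊤) :
    extSpectralRadius A = spectralRadius ℂ (toComplexMatrix A) := by
  rw [extSpectralRadius, if_pos hA]
  rfl

lemma ne_top_of_extSpectralRadius_ne_top {A : Matrix (Fin k) (Fin k) ℝ≥0∞}
    (h : extSpectralRadius A ≠ ⊤) : ∀ i j, A i j ≠ ⊤ := by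
  by_contra hA
  rw [extSpectralRadius, if_neg hA] at h
  exact h rfl

/-- In the `ℓ^∞` operator norm, the norm of a nonnegative matrix is its largest row sum, and `ϱ(A)^n
≤ ϱ(A^n) ≤ ‖A^n‖`. The empty index set is separate because there the identity does not have norm
one. -/
lemma extSpectralRadius_pow_le {A : Matrix (Fin k) (Fin k) ℝ≥0∞} (hA : ∀ i j, A i j ≠ ⊤) {n : ℕ}
    (hn : n ≠ 0) {C : ℝ≥0∞} (h : ∀ i, ∑ j, (A ^ n) i j ≤ C) : extSpectralRadius A ^ n ≤ C := by
  rcases Nat.eq_zero_or_pos k with rfl | hk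
  · rw [extSpectralRadius_of_ne_top hA]
    simp [hn, spectrum.SpectralRadius.of_subsingleton]
  have : Nonempty (Fin k) := ⟨⟨0, hk⟩⟩
  rw [extSpectralRadius_of_ne_top hA]
  refine (spectrum.spectralRadius_pow_le _ n hn).trans ?_
  rw [← toComplexMatrix_pow hA]
  exact (spectrum.spectralRadius_le_nnnorm _).trans
    (nnnorm_le_of_rowSum_le (pow_apply_ne_top hA n) h)

lemma extSpectralRadius_ne_top {A : Matrix (Fin k) (Fin k) ℝ≥0∞} (hA : ∀ i j, A i j ≠ ⊤) :
    extSpectralRadius A ≠ ⊤ := by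
  have h := extSpectralRadius_pow_le hA one_ne_zero (C := ∑ i, ∑ j, A i j) fun i => by
    rw [pow_one]
    exact Finset.single_le_sum (f := fun i => ∑ j, A i j) (fun _ _ => zero_le) (Finset.mem_univ i)
  rw [pow_one] at h
  exact (h.trans_lt (ENNReal.sum_ne_top.mpr fun i _ =>
    ENNReal.sum_ne_top.mpr fun j _ => hA i j).lt_top).ne

/-- Gelfand's formula in the row-sum norm. -/
lemma eventually_rowSum_pow_le {A : Matrix (Fin k) (Fin k) ℝ≥0∞} {R : ℝ≥0∞}
    (hR : extSpectralRadius A < R) : ∀ᶠ m : ℕ in atTop, ∀ i, ∑ j, (A ^ m) i j ≤ R ^ m := by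
  have hA := ne_top_of_extSpectralRadius_ne_top hR.ne_top
  rw [extSpectralRadius_of_ne_top hA] at hR
  have h := spectrum.pow_nnnorm_pow_one_div_tendsto_nhds_spectralRadius (toComplexMatrix A)
  filter_upwards [h.eventually_lt_const hR, eventually_gt_atTop 0] with m hm hm0 i
  refine (rowSum_le_nnnorm (pow_apply_ne_top hA m) i).trans ?_
  rw [toComplexMatrix_pow hA, ← ENNReal.rpow_natCast, ← ENNReal.rpow_inv_le_iff (by positivity)]
  simpa using hm.le

/-- The spectral radius of an irreducible matrix is controlled by the growth of one diagonal
entry of its powers. -/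
lemma extSpectralRadius_le_of_diag_le {A : Matrix (Fin k) (Fin k) ℝ≥0∞}
    (hA : ∀ i j, ∃ m > 0, (A ^ m) i j ≠ 0) (c : Fin k) {R : ℝ≥0∞} (hR0 : R ≠ 0) (hR : R ≠ ⊤)
    (h : ∀ m > 0, (A ^ m) c c ≤ R ^ m) : extSpectralRadius A ≤ R := by
  choose a ha0 ha using fun i => hA c i
  choose b hb0 hb using fun j => hA j c
  -- Any path from `i` to `j` is completed to a loop at `c` by fixed connections `c → i` and `j →
  -- c`. Hence every entry obeys the diagonal bound up to a constant, and no entry of `A` can be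
  -- infinite.
  have hkey : ∀ n i j, (A ^ a i) c i * (A ^ n) i j * (A ^ b j) j c ≤ R ^ (a i + n + b j) := by
    intro n i j
    refine le_trans ?_ (h _ (by have := ha0 i; omega))
    rw [pow_add, pow_add]
    refine le_trans ?_ (mul_apply_le_mul_apply _ _ c j c)
    gcongr
    exact mul_apply_le_mul_apply _ _ c i j
  have hfin : ∀ i j, A i j ≠ ⊤ := by
    intro i j htop
    have := hkey 1 i j
    rw [pow_one, htop, ENNReal.mul_top (ha i), ENNReal.top_mul (hb j), top_le_iff] at this
    exact ENNReal.pow_ne_top hR this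
  have hpf := pow_apply_ne_top hfin
  set Q : Fin k → Fin k → ℝ≥0∞ := fun i j =>
    R ^ (a i + b j) / ((A ^ a i) c i * (A ^ b j) j c) with hQ
  have hQtop : ∀ i j, Q i j ≠ ⊤ := fun i j =>
    ENNReal.div_ne_top (ENNReal.pow_ne_top hR) (mul_ne_zero (ha i) (hb j))
  have hbound : ∀ n i j, (A ^ n) i j ≤ Q i j * R ^ n := by
    intro n i j
    rw [hQ]
    simp only
    rw [← ENNReal.mul_div_right_comm, ENNReal.le_div_iff_mul_le
      (Or.inl (mul_ne_zero (ha i) (hb j))) (Or.inl (ENNReal.mul_ne_top (hpf _ _ _) (hpf _ _ _)))]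
    calc (A ^ n) i j * ((A ^ a i) c i * (A ^ b j) j c)
        = (A ^ a i) c i * (A ^ n) i j * (A ^ b j) j c := by ring
      _ ≤ R ^ (a i + n + b j) := hkey n i j
      _ = R ^ (a i + b j) * R ^ n := by rw [← pow_add]; congr 1; ring
  set C := ∑ i, ∑ j, Q i j with hC
  have hCtop : C ≠ ⊤ :=
    ENNReal.sum_ne_top.mpr fun i _ => ENNReal.sum_ne_top.mpr fun j _ => hQtop i j
  have hrow : ∀ n i, ∑ j, (A ^ n) i j ≤ C * R ^ n := by
    intro n i
    refine (Finset.sum_le_sum fun j _ => hbound n i j).trans ?_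
    rw [← Finset.sum_mul]
    gcongr
    exact Finset.single_le_sum (f := fun i => ∑ j, Q i j) (fun _ _ => zero_le)
      (Finset.mem_univ i)
  by_contra! hlt
  -- Bounded powers force the ratio to be at most one.
  have hratio : ∀ n : ℕ, n ≠ 0 → (extSpectralRadius A / R) ^ n ≤ C := by
    intro n hn
    rw [div_eq_mul_inv, mul_pow, ← ENNReal.inv_pow, ← div_eq_mul_inv,
      ENNReal.div_le_iff (pow_ne_zero n hR0) (ENNReal.pow_ne_top hR)]
    exact extSpectralRadius_pow_le hfin hn (hrow n)
  have h1 : 1 < extSpectralRadius A / R := by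
    rw [ENNReal.lt_div_iff_mul_lt (Or.inl hR0) (Or.inl hR)]
    simpa using hlt
  have h2 := ENNReal.tendsto_pow_atTop_nhds_top_iff.mpr h1
  obtain ⟨n, hn, hn0⟩ := ((h2.eventually (lt_mem_nhds hCtop.lt_top)).and
    (eventually_ne_atTop 0)).exists
  exact absurd (hratio n hn0) (not_le.mpr hn)

end Matrix

/-! ### A local lower bound for the coefficients of powers of a polynomial -/

lemma eventually_lt_of_hasDerivAt_neg {u : ℝ → ℝ} {a : ℝ} (h : HasDerivAt u a 0) (ha : a < 0) :
    ∀ᶠ s in 𝓝[>] (0 : ℝ), u s < u 0 := by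
  have h1 := (hasDerivAt_iff_tendsto_slope.mp h).mono_left
    (nhdsWithin_mono 0 fun s (hs : 0 < s) => hs.ne')
  filter_upwards [h1.eventually_lt_const ha, self_mem_nhdsWithin] with s hs hs0
  have hs0' : (0 : ℝ) < s := hs0
  rw [slope_def_field, sub_zero, div_neg_iff] at hs
  rcases hs with hs | hs
  · linarith [hs.2]
  · linarith [hs.1]

/-- Chernoff's inequality for the coefficients of a polynomial. -/
lemma sum_filter_mul_exp_le (q : Polynomial ℝ) (hq : ∀ n, 0 ≤ q.coeff n) (t s a : ℝ)
    (P : ℕ → Prop) [DecidablePred P] (hP : ∀ n, P n → 0 ≤ s * (n - a)) :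
    ∑ n ∈ q.support with P n, q.coeff n * Real.exp (t * n) ≤
      Real.exp (-(s * a)) * q.eval (Real.exp (t + s)) := by
  rw [Polynomial.eval_eq_sum, Polynomial.sum, Finset.mul_sum]
  refine (Finset.sum_le_sum fun n hn => ?_).trans
    (Finset.sum_le_sum_of_subset_of_nonneg (Finset.filter_subset P q.support) fun n _ _ => ?_)
  · have h1 := hP n (Finset.mem_filter.mp hn).2
    calc q.coeff n * Real.exp (t * n)
        ≤ q.coeff n * Real.exp (-(s * a) + n * (t + s)) := by
          refine mul_le_mul_of_nonneg_left (Real.exp_le_exp.mpr ?_) (hq n)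
          linarith
      _ = Real.exp (-(s * a)) * (q.coeff n * Real.exp (t + s) ^ n) := by
          rw [Real.exp_add, ← Real.exp_nat_mul]
          ring
  · exact mul_nonneg (Real.exp_pos _).le (mul_nonneg (hq n) (pow_nonneg (Real.exp_pos _).le n))

lemma coeff_pow_nonneg {p : Polynomial ℝ} (hp : ∀ n, 0 ≤ p.coeff n) (l n : ℕ) :
    0 ≤ (p ^ l).coeff n := by
  induction l generalizing n with
  | zero =>
    rw [pow_zero, Polynomial.coeff_one]
    split_ifs <;> norm_num
  | succ l ih =>
    rw [pow_succ, Polynomial.coeff_mul]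
    exact Finset.sum_nonneg fun x _ => mul_nonneg (ih _) (hp _)

/-- Cramér's lower bound at the mean of an exponentially tilted measure. -/
lemma eventually_le_sum_coeff_pow {p : Polynomial ℝ} (hp : ∀ n, 0 ≤ p.coeff n) {t y : ℝ}
    (hpos : 0 < p.eval (Real.exp t))
    (hder : HasDerivAt (fun s => p.eval (Real.exp s)) (y * p.eval (Real.exp t)) t)
    {η : ℝ} (hη : 0 < η) :
    ∀ᶠ l : ℕ in atTop, 1 / 2 * (p.eval (Real.exp t) * Real.exp (-(t * y) - |t| * η)) ^ l ≤
      ∑ n ∈ (p ^ l).support.filter fun n : ℕ => |(n : ℝ) - l * y| ≤ l * η, (p ^ l).coeff n := by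
  set Z := p.eval (Real.exp t) with hZ
  -- Here `y` is the mean of the tilted law. The exponential moment beyond a distance `η` above the
  -- mean has negative derivative at `s = 0`, hence is below `Z` for small `s > 0`; `hd2` treats the
  -- lower tail, and one `s` serves both.
  have hd1 : HasDerivAt (fun s => Real.exp (-(s * (y + η))) * p.eval (Real.exp (t + s)))
      (-(η * Z)) 0 := by
    have h1 : HasDerivAt (fun s : ℝ => p.eval (Real.exp (t + s))) (y * Z) 0 :=
      HasDerivAt.comp_const_add t 0 (by simpa using hder)
    have h2 : HasDerivAt (fun s : ℝ => Real.exp (-(s * (y + η)))) (-(y + η)) 0 := by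
      have := (((hasDerivAt_id (0 : ℝ)).mul_const (y + η)).neg).exp
      simpa using this
    refine (h2.fun_mul h1).congr_deriv ?_
    simp only [zero_mul, neg_zero, Real.exp_zero, add_zero, one_mul, ← hZ]
    ring
  have hd2 : HasDerivAt (fun s => Real.exp (-(-s * (y - η))) * p.eval (Real.exp (t + -s)))
      (-(η * Z)) 0 := by
    have h1 : HasDerivAt (fun s : ℝ => p.eval (Real.exp (t + -s))) (-(y * Z)) 0 := by
      have h0 : HasDerivAt (fun s : ℝ => t + -s) (-1) 0 := (hasDerivAt_neg 0).const_add t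
      have hder' : HasDerivAt (fun s => p.eval (Real.exp s)) (y * Z) (t + -0) := by
        simpa using hder
      have h3 : HasDerivAt (fun s : ℝ => p.eval (Real.exp (t + -s))) (y * Z * -1) 0 :=
        HasDerivAt.comp (h₂ := fun s => p.eval (Real.exp s)) (0 : ℝ) hder' h0
      exact h3.congr_deriv (by ring)
    have h2 : HasDerivAt (fun s : ℝ => Real.exp (-(-s * (y - η)))) (y - η) 0 := by
      have := (((hasDerivAt_neg (0 : ℝ)).mul_const (y - η)).neg).exp
      simpa using this
    refine (h2.fun_mul h1).congr_deriv ?_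
    simp only [zero_mul, neg_zero, Real.exp_zero, add_zero, one_mul, ← hZ]
    ring
  have hneg : -(η * Z) < 0 := neg_lt_zero.mpr (mul_pos hη hpos)
  obtain ⟨s, ⟨hs1, hs2⟩, hs0⟩ := (((eventually_lt_of_hasDerivAt_neg hd1 hneg).and
    (eventually_lt_of_hasDerivAt_neg hd2 hneg)).and self_mem_nhdsWithin).exists
  have hs : (0 : ℝ) < s := hs0
  simp only [zero_mul, neg_zero, Real.exp_zero, add_zero, one_mul, ← hZ] at hs1 hs2
  set Z₁ := Real.exp (-(s * (y + η))) * p.eval (Real.exp (t + s)) with hZ1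
  set Z₂ := Real.exp (-(-s * (y - η))) * p.eval (Real.exp (t + -s)) with hZ2
  have heval : ∀ r : ℝ, 0 ≤ p.eval (Real.exp r) := by
    intro r
    rw [Polynomial.eval_eq_sum]
    exact Finset.sum_nonneg fun n _ => mul_nonneg (hp n) (pow_nonneg (Real.exp_pos _).le n)
  have hZ1' : 0 ≤ Z₁ := mul_nonneg (Real.exp_pos _).le (heval _)
  have hZ2' : 0 ≤ Z₂ := mul_nonneg (Real.exp_pos _).le (heval _)
  have hsmall : ∀ a : ℝ, 0 ≤ a → a < Z → ∀ᶠ l : ℕ in atTop, a ^ l ≤ 1 / 4 * Z ^ l := by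
    intro a ha haZ
    have h := tendsto_pow_atTop_nhds_zero_of_lt_one (div_nonneg ha hpos.le)
      ((div_lt_one hpos).mpr haZ)
    filter_upwards [h.eventually_lt_const (show (0 : ℝ) < 1 / 4 by norm_num)] with l hl
    rw [div_pow, div_lt_iff₀ (pow_pos hpos l)] at hl
    exact hl.le
  filter_upwards [hsmall Z₁ hZ1' hs1, hsmall Z₂ hZ2' hs2] with l hl1 hl2
  set q := p ^ l with hq
  have hqn : ∀ n, 0 ≤ q.coeff n := coeff_pow_nonneg hp l
  have htot : Z ^ l = ∑ n ∈ q.support, q.coeff n * Real.exp (t * n) := by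
    rw [hZ, ← Polynomial.eval_pow, Polynomial.eval_eq_sum, Polynomial.sum]
    exact Finset.sum_congr rfl fun n _ => by rw [← Real.exp_nat_mul, mul_comm t]
  have hup : ∑ n ∈ q.support.filter fun n : ℕ => l * (y + η) ≤ (n : ℝ),
      q.coeff n * Real.exp (t * n) ≤ Z₁ ^ l := by
    refine (sum_filter_mul_exp_le q hqn t s (l * (y + η)) _ fun n hn =>
      mul_nonneg hs.le (by linarith)).trans (le_of_eq ?_)
    rw [hq, Polynomial.eval_pow, hZ1, mul_pow, ← Real.exp_nat_mul]
    ring_nf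
  have hdown : ∑ n ∈ q.support.filter fun n : ℕ => (n : ℝ) ≤ l * (y - η),
      q.coeff n * Real.exp (t * n) ≤ Z₂ ^ l := by
    refine (sum_filter_mul_exp_le q hqn t (-s) (l * (y - η)) _ fun n hn =>
      mul_nonneg_of_nonpos_of_nonpos (by linarith) (by linarith)).trans (le_of_eq ?_)
    rw [hq, Polynomial.eval_pow, hZ2, mul_pow, ← Real.exp_nat_mul]
    ring_nf
  -- On the window the tilt is removed at a cost of at most `t y + |t| η` in the exponent per
  -- factor.
  have hnear : ∑ n ∈ q.support.filter fun n : ℕ => |(n : ℝ) - l * y| ≤ l * η,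
      q.coeff n * Real.exp (t * n) ≤
      Real.exp (t * y + |t| * η) ^ l *
        ∑ n ∈ q.support.filter fun n : ℕ => |(n : ℝ) - l * y| ≤ l * η, q.coeff n := by
    rw [Finset.mul_sum]
    refine Finset.sum_le_sum fun n hn => ?_
    have hn' := (Finset.mem_filter.mp hn).2
    rw [mul_comm, ← Real.exp_nat_mul]
    refine mul_le_mul_of_nonneg_right (Real.exp_le_exp.mpr ?_) (hqn n)
    have h1 : t * (n - l * y) ≤ |t| * (l * η) :=
      (le_abs_self _).trans (by rw [abs_mul]; gcongr)
    linarith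
  -- The total tilted mass is `Z ^ l`. Each tail is at most a quarter of it for large `l`, so the
  -- window keeps at least half.
  have hsplit : Z ^ l ≤
      ∑ n ∈ q.support.filter fun n : ℕ => |(n : ℝ) - l * y| ≤ l * η, q.coeff n * Real.exp (t * n) +
      (∑ n ∈ q.support.filter fun n : ℕ => l * (y + η) ≤ (n : ℝ), q.coeff n * Real.exp (t * n) +
       ∑ n ∈ q.support.filter fun n : ℕ => (n : ℝ) ≤ l * (y - η), q.coeff n * Real.exp (t * n)) := by
    rw [htot, Finset.sum_filter, Finset.sum_filter, Finset.sum_filter, ← Finset.sum_add_distrib,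
      ← Finset.sum_add_distrib]
    refine Finset.sum_le_sum fun n _ => ?_
    have hterm : 0 ≤ q.coeff n * Real.exp (t * n) := mul_nonneg (hqn n) (Real.exp_pos _).le
    by_cases h1 : |(n : ℝ) - l * y| ≤ l * η
    · rw [if_pos h1]
      have : ∀ (Q : Prop) [Decidable Q], 0 ≤ if Q then q.coeff n * Real.exp (t * n) else 0 := by
        intro Q _
        split_ifs
        · exact hterm
        · exact le_rfl
      linarith [this (l * (y + η) ≤ (n : ℝ)), this ((n : ℝ) ≤ l * (y - η))]
    · rw [if_neg h1]
      rcases lt_abs.mp (not_le.mp h1) with h | h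
      · rw [if_pos (show l * (y + η) ≤ (n : ℝ) by linarith)]
        split_ifs <;> linarith
      · rw [if_pos (show (n : ℝ) ≤ l * (y - η) by linarith)]
        split_ifs <;> linarith
  have hhalf : 1 / 2 * Z ^ l ≤ Real.exp (t * y + |t| * η) ^ l *
      ∑ n ∈ q.support.filter fun n : ℕ => |(n : ℝ) - l * y| ≤ l * η, q.coeff n := by linarith
  have hexp : Real.exp (-(t * y) - |t| * η) ^ l * Real.exp (t * y + |t| * η) ^ l = 1 := by
    rw [← mul_pow, ← Real.exp_add]
    simp
  calc 1 / 2 * (Z * Real.exp (-(t * y) - |t| * η)) ^ l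
      = Real.exp (-(t * y) - |t| * η) ^ l * (1 / 2 * Z ^ l) := by rw [mul_pow]; ring
    _ ≤ Real.exp (-(t * y) - |t| * η) ^ l * (Real.exp (t * y + |t| * η) ^ l *
        ∑ n ∈ q.support.filter fun n : ℕ => |(n : ℝ) - l * y| ≤ l * η, q.coeff n) :=
        mul_le_mul_of_nonneg_left hhalf (pow_nonneg (Real.exp_pos _).le l)
    _ = _ := by rw [← mul_assoc, hexp, one_mul]

/-! ### Supermultiplicative families of finite measures -/

/-- Taking logarithms, the quadratic penalty beats the linear terms for large `|t|`. A bound by a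
single exponential from below therefore suffices for compactness. -/
lemma isCompact_setOf_le_exp {w : ℝ → ℝ} (hw : Continuous w) {a b : ℝ} (ha : 0 < a)
    (h : ∀ t, a * Real.exp (t * b) ≤ w t) (c x : ℝ) {δ : ℝ} (hδ : 0 < δ) :
    IsCompact {t : ℝ | w t ≤ Real.exp (c + t * x - δ * t ^ 2)} := by
  have hclosed : IsClosed {t : ℝ | w t ≤ Real.exp (c + t * x - δ * t ^ 2)} :=
    isClosed_le hw (by fun_prop)
  refine Metric.isCompact_of_isClosed_isBounded hclosed
    ((Metric.isBounded_closedBall (x := (0 : ℝ))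
      (r := (|c - Real.log a| + |x - b|) / δ + 1)).subset ?_)
  intro t ht
  rw [mem_closedBall_zero_iff, Real.norm_eq_abs]
  have h1 : Real.log a + t * b ≤ c + t * x - δ * t ^ 2 := by
    rw [← Real.exp_le_exp, Real.exp_add, Real.exp_log ha]
    exact (h t).trans ht
  have h2 : δ * |t| ^ 2 ≤ |c - Real.log a| + |t| * |x - b| := by
    rw [sq_abs, ← abs_mul]
    linarith [le_abs_self (c - Real.log a), le_abs_self (t * (x - b))]
  rcases le_or_gt |t| 1 with h3 | h3
  · have : 0 ≤ (|c - Real.log a| + |x - b|) / δ := by positivity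
    linarith
  · have h4 : δ * |t| * |t| ≤ (|c - Real.log a| + |x - b|) * |t| := by
      nlinarith [abs_nonneg (c - Real.log a)]
    have h5 := le_of_mul_le_mul_right h4 (by linarith)
    have h6 : |t| ≤ (|c - Real.log a| + |x - b|) / δ := by
      rw [le_div_iff₀ hδ]
      linarith
    linarith

/-- The generating polynomial of the restriction of `f m` to `{0, …, L}`. -/
def truncPoly (f : ℕ → ℕ → ℝ) (m L : ℕ) : Polynomial ℝ :=
  ∑ n ∈ Finset.range (L + 1), Polynomial.monomial n (f m n)

section Super

variable {f : ℕ → ℕ → ℝ}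

lemma coeff_truncPoly (m L n : ℕ) :
    (truncPoly f m L).coeff n = if n < L + 1 then f m n else 0 := by
  simp [truncPoly, Polynomial.finsetSum_coeff, Polynomial.coeff_monomial]

lemma eval_truncPoly (m L : ℕ) (x : ℝ) :
    (truncPoly f m L).eval x = ∑ n ∈ Finset.range (L + 1), f m n * x ^ n := by
  simp [truncPoly, Polynomial.eval_finsetSum]

lemma natDegree_truncPoly_le (m L : ℕ) : (truncPoly f m L).natDegree ≤ L := by
  rw [Polynomial.natDegree_le_iff_coeff_eq_zero]
  intro n hn
  rw [coeff_truncPoly, if_neg (by omega)]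

lemma coeff_truncPoly_nonneg (hf : ∀ m n, 0 ≤ f m n) (m L n : ℕ) :
    0 ≤ (truncPoly f m L).coeff n := by
  rw [coeff_truncPoly]
  split_ifs
  · exact hf m n
  · exact le_rfl

lemma coeff_truncPoly_pow_le (hf : ∀ m n, 0 ≤ f m n) (hzero : f 0 0 = 1)
    (hconv : ∀ m m' n,
      ∑ x ∈ Finset.HasAntidiagonal.antidiagonal n, f m x.1 * f m' x.2 ≤ f (m + m') n)
    (m L q n : ℕ) : ((truncPoly f m L) ^ q).coeff n ≤ f (m * q) n := by
  induction q generalizing n with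
  | zero =>
    rw [pow_zero, Polynomial.coeff_one, mul_zero]
    split_ifs with h
    · rw [h, hzero]
    · exact hf 0 n
  | succ q ih =>
    rw [pow_succ, Polynomial.coeff_mul, mul_add, mul_one]
    refine (Finset.sum_le_sum fun x _ => ?_).trans (hconv (m * q) m n)
    refine mul_le_mul (ih _) ?_ (coeff_truncPoly_nonneg hf _ _ _) (hf _ _)
    rw [coeff_truncPoly]
    split_ifs
    · exact le_rfl
    · exact hf _ _

/-- Supermultiplicativity at the level of generating polynomials: whatever `(m, L)` achieves at `x`,
the pair `(m * q, L')` achieves to the power `q`. This makes the family directed. -/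
lemma eval_truncPoly_pow_le (hf : ∀ m n, 0 ≤ f m n) (hzero : f 0 0 = 1)
    (hconv : ∀ m m' n,
      ∑ x ∈ Finset.HasAntidiagonal.antidiagonal n, f m x.1 * f m' x.2 ≤ f (m + m') n)
    (m : ℕ) {L L' q : ℕ} (hL : L * q ≤ L') {x : ℝ} (hx : 0 ≤ x) :
    (truncPoly f m L).eval x ^ q ≤ (truncPoly f (m * q) L').eval x := by
  have hdeg : ((truncPoly f m L) ^ q).natDegree < L' + 1 := by
    have h1 := Polynomial.natDegree_pow_le (p := truncPoly f m L) (n := q)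
    have h2 := Nat.mul_le_mul_left q (natDegree_truncPoly_le (f := f) m L)
    rw [mul_comm q L] at h2
    omega
  rw [← Polynomial.eval_pow, Polynomial.eval_eq_sum_range' hdeg, eval_truncPoly]
  exact Finset.sum_le_sum fun n _ => mul_le_mul_of_nonneg_right
    (coeff_truncPoly_pow_le hf hzero hconv m L q n) (pow_nonneg hx n)

lemma continuous_eval_exp (p : Polynomial ℝ) : Continuous fun t => p.eval (Real.exp t) :=
  p.continuous.comp Real.continuous_exp

lemma exists_mul_exp_le_eval (hf : ∀ m n, 0 ≤ f m n) {m L : ℕ}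
    (h : 0 < (truncPoly f m L).eval 1) :
    ∃ a > 0, ∃ b, ∀ t, a * Real.exp (t * b) ≤ (truncPoly f m L).eval (Real.exp t) := by
  rw [eval_truncPoly] at h
  obtain ⟨n, hn, hpos⟩ := Finset.exists_lt_of_sum_lt (s := Finset.range (L + 1)) (f := fun _ => 0)
    (g := fun n => f m n * 1 ^ n) (by simpa using h)
  refine ⟨f m n, by simpa using hpos, n, fun t => ?_⟩
  rw [eval_truncPoly, mul_comm t, Real.exp_nat_mul]
  exact Finset.single_le_sum (f := fun n => f m n * Real.exp t ^ n)
    (fun n _ => mul_nonneg (hf m n) (pow_nonneg (Real.exp_pos _).le n)) hn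

/-- A compactness argument: one member of a supermultiplicative family beats a linear function,
up to a small quadratic error, if the family does so pointwise. -/
lemma exists_forall_exp_lt_eval (hf : ∀ m n, 0 ≤ f m n) (hzero : f 0 0 = 1)
    (hconv : ∀ m m' n,
      ∑ x ∈ Finset.HasAntidiagonal.antidiagonal n, f m x.1 * f m' x.2 ≤ f (m + m') n)
    {c x : ℝ} (h : ∀ t : ℝ, ∃ m : ℕ, 0 < m ∧ ∃ L,
      Real.exp (m * (c + t * x)) < (truncPoly f m L).eval (Real.exp t)) {δ : ℝ} (hδ : 0 < δ) :
    ∃ m : ℕ, 0 < m ∧ ∃ L, ∀ t : ℝ,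
      Real.exp (m * (c + t * x - δ * t ^ 2)) < (truncPoly f m L).eval (Real.exp t) := by
  obtain ⟨m₀, hm₀, L₀, h₀⟩ := h 0
  have hpos : 0 < (truncPoly f m₀ L₀).eval 1 := by
    rw [Real.exp_zero] at h₀
    exact (Real.exp_pos _).trans h₀
  -- The set of bad tilts for `(m, L)`. It shrinks when `m` is replaced by a multiple and the
  -- truncation is lengthened enough; the term `δ t^2` makes the first one compact.
  set Z : ℕ → ℕ → Set ℝ := fun m L =>
    {t | (truncPoly f m L).eval (Real.exp t) ≤ Real.exp (m * (c + t * x - δ * t ^ 2))} with hZ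
  have hclosed : ∀ m L, IsClosed (Z m L) := fun m L =>
    isClosed_le (continuous_eval_exp _) (by fun_prop)
  have hmono : ∀ m L q L', 0 < q → L * q ≤ L' → Z (m * q) L' ⊆ Z m L := by
    intro m L q L' hq hL t ht
    have h1 := eval_truncPoly_pow_le hf hzero hconv m hL (Real.exp_pos t).le
    have h2 : (truncPoly f m L).eval (Real.exp t) ^ q ≤
        Real.exp (m * (c + t * x - δ * t ^ 2)) ^ q := by
      refine (h1.trans ht).trans (le_of_eq ?_)
      rw [← Real.exp_nat_mul]
      push_cast
      ring_nf
    exact le_of_pow_le_pow_left₀ hq.ne' (Real.exp_pos _).le h2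
  have hcomp : IsCompact (Z m₀ L₀) := by
    obtain ⟨a, ha, b, hab⟩ := exists_mul_exp_le_eval hf hpos
    have := isCompact_setOf_le_exp (continuous_eval_exp (truncPoly f m₀ L₀)) ha hab (m₀ * c)
      (m₀ * x) (δ := m₀ * δ) (by positivity)
    convert this using 4
    ring_nf
  have : Nonempty {i : ℕ × ℕ // 0 < i.1} := ⟨⟨(m₀, L₀), hm₀⟩⟩
  obtain ⟨⟨⟨m, L⟩, hm⟩, hcover⟩ := hcomp.elim_directed_cover
    (fun i : {i : ℕ × ℕ // 0 < i.1} => (Z i.1.1 i.1.2)ᶜ) (fun i => (hclosed _ _).isOpen_compl)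
    (by
      intro t _
      obtain ⟨m, hm, L, hmL⟩ := h t
      refine Set.mem_iUnion.mpr ⟨⟨(m, L), hm⟩, ?_⟩
      simp only [hZ, Set.mem_compl_iff, Set.mem_ofPred_eq, not_le]
      refine lt_of_le_of_lt (Real.exp_le_exp.mpr ?_) hmL
      have : 0 ≤ δ * t ^ 2 := by positivity
      gcongr
      linarith)
    (by
      rintro ⟨⟨m, L⟩, hm⟩ ⟨⟨m', L'⟩, hm'⟩
      -- The common multiple, with a truncation long enough for both powers, improves on both pairs.
      refine ⟨⟨(m * m', L * m' + L' * m), Nat.mul_pos hm hm'⟩, ?_, ?_⟩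
      · exact Set.compl_subset_compl.mpr (hmono m L m' _ hm' (Nat.le_add_right _ _))
      · have := hmono m' L' m _ hm (Nat.le_add_left (L' * m) (L * m'))
        rw [mul_comm m' m] at this
        exact Set.compl_subset_compl.mpr this)
  refine ⟨m₀ * m, Nat.mul_pos hm₀ hm, L₀ * m + L * m₀, fun t => ?_⟩
  by_contra ht
  have ht' : t ∈ Z (m₀ * m) (L₀ * m + L * m₀) := not_lt.mp ht
  have h1 := hmono m₀ L₀ m _ hm (Nat.le_add_right _ (L * m₀)) ht'
  rw [mul_comm m₀ m] at ht'
  exact hcover h1 (hmono m L m₀ _ hm₀ (Nat.le_add_left _ _) ht')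

lemma hasDerivAt_eval_truncPoly_exp (m L : ℕ) (t : ℝ) :
    HasDerivAt (fun s => (truncPoly f m L).eval (Real.exp s))
      (∑ n ∈ Finset.range (L + 1), f m n * (n * Real.exp (t * n))) t := by
  have h : (fun s => (truncPoly f m L).eval (Real.exp s)) =
      fun s => ∑ n ∈ Finset.range (L + 1), f m n * Real.exp (s * n) := by
    ext s
    rw [eval_truncPoly]
    exact Finset.sum_congr rfl fun n _ => by rw [← Real.exp_nat_mul, mul_comm s]
  rw [h]
  refine HasDerivAt.fun_sum fun n _ => HasDerivAt.const_mul _ ?_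
  have := ((hasDerivAt_id t).mul_const (n : ℝ)).exp
  simpa [mul_comm] using this

/-- Selection of a truncated measure and of a tilt: the tilted mean is close to `m * x`, and the
exponential cost of the tilt is controlled. -/
lemma exists_tilt (hf : ∀ m n, 0 ≤ f m n) (hzero : f 0 0 = 1)
    (hconv : ∀ m m' n,
      ∑ x ∈ Finset.HasAntidiagonal.antidiagonal n, f m x.1 * f m' x.2 ≤ f (m + m') n)
    (hone : ∀ m L, (truncPoly f m L).eval 1 ≤ 1)
    {c x : ℝ} (h : ∀ t : ℝ, ∃ m : ℕ, 0 < m ∧ ∃ L,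
      Real.exp (m * (c + t * x)) < (truncPoly f m L).eval (Real.exp t)) {η : ℝ} (hη : 0 < η) :
    ∃ m : ℕ, 0 < m ∧ ∃ L, ∃ t y : ℝ,
      HasDerivAt (fun s => (truncPoly f m L).eval (Real.exp s))
        (y * (truncPoly f m L).eval (Real.exp t)) t ∧
      Real.exp (m * c) < (truncPoly f m L).eval (Real.exp t) * Real.exp (-(t * y)) ∧
      |y - m * x| ≤ m * η := by
  -- Chosen so that `4 δ |c| ≤ η^2`, which is what controls the displacement of the mean at the end.
  set δ : ℝ := η ^ 2 / (4 * |c| + 1) with hδdef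
  have hδ : 0 < δ := by positivity
  obtain ⟨m, hm, L, hmL⟩ := exists_forall_exp_lt_eval hf hzero hconv h hδ
  have hm' : (0 : ℝ) < m := by exact_mod_cast hm
  set w : ℝ → ℝ := fun t => (truncPoly f m L).eval (Real.exp t) with hw
  have hwpos : ∀ t, 0 < w t := fun t => (Real.exp_pos _).trans (hmL t)
  have hwc : Continuous w := continuous_eval_exp _
  -- The penalised function has compact sublevel sets, so its minimum is attained even if `w t * exp
  -- (-t m x)` has no minimiser. The critical equation says that the mean tilted by `t` is `m x - 2
  -- m δ t`.
  set u : ℝ → ℝ := fun t => w t * Real.exp (-(t * (m * x)) + m * δ * t ^ 2) with hu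
  have huc : Continuous u := by fun_prop
  obtain ⟨a, ha, b, hab⟩ := exists_mul_exp_le_eval hf
    (show 0 < (truncPoly f m L).eval 1 by simpa [hw] using hwpos 0)
  have hcomp : IsCompact {t | u t ≤ u 0} := by
    have := isCompact_setOf_le_exp hwc ha hab (Real.log (u 0)) (m * x) (δ := m * δ) (by positivity)
    convert this using 3 with t
    have hu0 : 0 < u 0 := mul_pos (hwpos 0) (Real.exp_pos _)
    rw [show Real.log (u 0) + t * (m * x) - m * δ * t ^ 2 =
      Real.log (u 0) - (-(t * (m * x)) + m * δ * t ^ 2) by ring, Real.exp_sub, Real.exp_log hu0,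
      le_div_iff₀ (Real.exp_pos _)]
  obtain ⟨t, ht, hmin⟩ := hcomp.exists_isMinOn ⟨0, by simp⟩ huc.continuousOn
  have hmin' : ∀ s, u t ≤ u s := by
    intro s
    by_cases hs : u s ≤ u 0
    · exact hmin hs
    · have : u t ≤ u 0 := ht
      linarith
  set w' := ∑ n ∈ Finset.range (L + 1), f m n * (n * Real.exp (t * n)) with hw'
  have hdw : HasDerivAt w w' t := hasDerivAt_eval_truncPoly_exp m L t
  have hde : HasDerivAt (fun t => Real.exp (-(t * (m * x)) + m * δ * t ^ 2))
      (Real.exp (-(t * (m * x)) + m * δ * t ^ 2) * (-(m * x) + m * δ * (2 * t))) t := by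
    have h1 := ((hasDerivAt_id t).mul_const ((m : ℝ) * x)).neg
    have h2 := ((hasDerivAt_id t).pow 2).const_mul ((m : ℝ) * δ)
    have := (h1.add h2).exp
    simpa using this
  have hloc : IsLocalMin u t := Filter.Eventually.of_forall hmin'
  have hcrit := hloc.hasDerivAt_eq_zero (hdw.fun_mul hde)
  set y := m * x - 2 * (m * δ) * t with hy
  have hw'y : w' = y * w t := by
    have h1 : Real.exp (-(t * (m * x)) + m * δ * t ^ 2) * (w' - y * w t) = 0 := by
      rw [← hcrit, hy]
      ring
    have h2 := (mul_eq_zero.mp h1).resolve_left (Real.exp_pos _).ne'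
    linarith
  have hgain : Real.exp (m * c + m * δ * t ^ 2) < w t * Real.exp (-(t * y)) := by
    have h1 := mul_lt_mul_of_pos_right (hmL t) (Real.exp_pos (-(t * y)))
    rw [← Real.exp_add] at h1
    refine lt_of_eq_of_lt ?_ h1
    congr 1
    rw [hy]
    ring
  -- Jensen's inequality, from `1 + v ≤ exp v` at `v = -t (n - y)`: the first-order term cancels
  -- because `y` is the tilted mean.
  have hjensen : w t * Real.exp (-(t * y)) ≤ 1 := by
    refine le_trans ?_ (hone m L)
    have h1 : ∑ n ∈ Finset.range (L + 1),
        f m n * (Real.exp (t * n) * Real.exp (-(t * y)) * (1 - t * (n - y))) ≤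
        (truncPoly f m L).eval 1 := by
      rw [eval_truncPoly]
      refine Finset.sum_le_sum fun n _ => mul_le_mul_of_nonneg_left ?_ (hf m n)
      rw [one_pow, ← Real.exp_add]
      have h2 := Real.add_one_le_exp (-(t * (n - y)))
      calc Real.exp (t * n + -(t * y)) * (1 - t * (n - y))
          ≤ Real.exp (t * n + -(t * y)) * Real.exp (-(t * (n - y))) := by
            refine mul_le_mul_of_nonneg_left ?_ (Real.exp_pos _).le
            linarith
        _ = 1 := by rw [← Real.exp_add, Real.exp_eq_one_iff]; ring
    refine le_trans (le_of_eq ?_) h1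
    have h3 : w t = ∑ n ∈ Finset.range (L + 1), f m n * Real.exp (t * n) := by
      rw [hw]
      simp only [eval_truncPoly]
      exact Finset.sum_congr rfl fun n _ => by rw [← Real.exp_nat_mul, mul_comm t]
    calc w t * Real.exp (-(t * y))
        = Real.exp (-(t * y)) * ((1 + t * y) * w t - t * w') := by rw [hw'y]; ring
      _ = _ := by
        rw [h3, hw', Finset.mul_sum, Finset.mul_sum, ← Finset.sum_sub_distrib, Finset.mul_sum]
        exact Finset.sum_congr rfl fun n _ => by ring
  refine ⟨m, hm, L, t, y, hw'y ▸ hdw, lt_of_le_of_lt (Real.exp_le_exp.mpr ?_) hgain, ?_⟩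
  · have : 0 ≤ m * δ * t ^ 2 := by positivity
    linarith
  -- The minimiser `t` itself is not bounded. The gain and Jensen's inequality together give `δ t^2
  -- ≤ |c|`, hence `(2 δ t)^2 ≤ 4 δ |c| ≤ η^2`.
  · have h1 : m * c + m * δ * t ^ 2 < 0 := by
      rw [← Real.exp_lt_one_iff]
      exact hgain.trans_le hjensen
    have h2 : δ * t ^ 2 ≤ |c| := by
      have : m * (c + δ * t ^ 2) < m * 0 := by linarith
      have := lt_of_mul_lt_mul_left this hm'.le
      linarith [neg_abs_le c]
    have h3 : 4 * δ * |c| ≤ η ^ 2 := by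
      rw [hδdef]
      rw [show 4 * (η ^ 2 / (4 * |c| + 1)) * |c| = η ^ 2 * (4 * |c|) / (4 * |c| + 1) by ring,
        div_le_iff₀ (by positivity)]
      nlinarith [sq_nonneg η]
    have h4 : (2 * δ * t) ^ 2 ≤ η ^ 2 := by nlinarith
    have h5 := abs_le_of_sq_le_sq h4 hη.le
    rw [show y - m * x = -(m * (2 * δ * t)) by rw [hy]; ring, abs_neg, abs_mul, Nat.abs_cast]
    exact mul_le_mul_of_nonneg_left h5 hm'.le

end Super

/-! ### Extended-real bookkeeping -/

lemma ereal_sub_lt_coe_iff {a d : ℝ} {b : EReal} :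
    (a : EReal) - b < d ↔ ((a - d : ℝ) : EReal) < b := by
  induction b with
  | bot => simp
  | top => simp only [EReal.sub_top, EReal.bot_lt_coe, EReal.coe_lt_top]
  | coe b =>
    rw [← EReal.coe_sub, EReal.coe_lt_coe_iff, EReal.coe_lt_coe_iff]
    constructor <;> intro h <;> linarith

lemma exists_real_lt_of_lt_sub {a d : ℝ} {b : EReal} (h : (d : EReal) < a - b) :
    ∃ r : ℝ, b < r ∧ d < a - r := by
  induction b with
  | bot => exact ⟨a - d - 1, EReal.bot_lt_coe _, by linarith⟩
  | top => simp at h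
  | coe b =>
    rw [← EReal.coe_sub, EReal.coe_lt_coe_iff] at h
    refine ⟨(b + (a - d)) / 2, EReal.coe_lt_coe_iff.mpr ?_, ?_⟩ <;> linarith

lemma coe_le_inv_mul_log {m : ℕ} (hm : 0 < m) {c : ℝ} {p : ℝ≥0∞}
    (h : ENNReal.ofReal (Real.exp (m * c)) ≤ p) :
    (c : EReal) ≤ ((1 / (m : ℝ) : ℝ) : EReal) * ENNReal.log p := by
  have hm' : (0 : ℝ) < m := by exact_mod_cast hm
  have h1 := ENNReal.log_monotone h
  rw [ENNReal.log_ofReal_of_pos (Real.exp_pos _), Real.log_exp] at h1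
  generalize ENNReal.log p = b at h1 ⊢
  induction b with
  | bot => exact absurd h1 (not_le.mpr (EReal.bot_lt_coe _))
  | top => rw [EReal.coe_mul_top_of_pos (by positivity)]; exact le_top
  | coe b =>
    rw [EReal.coe_le_coe_iff] at h1
    rw [← EReal.coe_mul, EReal.coe_le_coe_iff, one_div, inv_mul_eq_div, le_div_iff₀ hm']
    linarith

lemma inv_mul_log_le_coe {m : ℕ} (hm : 0 < m) {c : ℝ} {p : ℝ≥0∞}
    (h : p ≤ ENNReal.ofReal (Real.exp (m * c))) :
    ((1 / (m : ℝ) : ℝ) : EReal) * ENNReal.log p ≤ c := by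
  have hm' : (0 : ℝ) < m := by exact_mod_cast hm
  have h1 := ENNReal.log_monotone h
  rw [ENNReal.log_ofReal_of_pos (Real.exp_pos _), Real.log_exp] at h1
  generalize ENNReal.log p = b at h1 ⊢
  induction b with
  | bot => rw [EReal.coe_mul_bot_of_pos (by positivity)]; exact bot_le
  | top => exact absurd h1 (not_le.mpr (EReal.coe_lt_top _))
  | coe b =>
    rw [EReal.coe_le_coe_iff] at h1
    rw [← EReal.coe_mul, EReal.coe_le_coe_iff, one_div, inv_mul_eq_div, div_le_iff₀ hm']
    linarith

/-! ### Large deviations for powers of a matrix power series -/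

section Series

variable {k : ℕ} (F : PowerSeries (Matrix (Fin k) (Fin k) ℝ≥0∞))

/-- The logarithm of the spectral radius of a matrix power series at `exp t`. -/
def logRadius (t : ℝ) : EReal :=
  ENNReal.log (extSpectralRadius (evalSeries F (ENNReal.ofReal (Real.exp t))))

/-- The row sum of the `n`-th coefficient of the `m`-th power. -/
def rowMass (c : Fin k) (m n : ℕ) : ℝ≥0∞ := ∑ j, PowerSeries.coeff n (F ^ m) c j

open Classical in
/-- The mass that row `c` of the `m`-th power puts on the exponents `n` with `n / m ∈ Γ`. -/
def meanMass (c : Fin k) (m : ℕ) (Γ : Set ℝ) : ℝ≥0∞ :=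
  ∑' n : ℕ, if (n / m : ℝ) ∈ Γ then rowMass F c m n else 0

lemma tsum_pow_mul_rowMass (c : Fin k) (m : ℕ) (z : ℝ≥0∞) :
    ∑' n : ℕ, z ^ n * rowMass F c m n = ∑ j, (evalSeries F z ^ m) c j := by
  simp only [← evalSeries_pow, evalSeries_apply, rowMass, Finset.mul_sum]
  rw [Summable.tsum_finsetSum fun _ _ => ENNReal.summable]

variable {F}

lemma tsum_rowMass_le_one (hsub : ∀ i, ∑ j, evalSeries F 1 i j ≤ 1) (c : Fin k) (m : ℕ) :
    ∑' n : ℕ, rowMass F c m n ≤ 1 := by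
  have := tsum_pow_mul_rowMass F c m 1
  simp only [one_pow, one_mul] at this
  rw [this]
  exact rowSum_pow_le_one hsub m c

lemma rowMass_le_one (hsub : ∀ i, ∑ j, evalSeries F 1 i j ≤ 1) (c : Fin k) (m n : ℕ) :
    rowMass F c m n ≤ 1 :=
  (ENNReal.le_tsum n).trans (tsum_rowMass_le_one hsub c m)

lemma coeff_le_rowMass (c : Fin k) (m n : ℕ) :
    PowerSeries.coeff n (F ^ m) c c ≤ rowMass F c m n :=
  Finset.single_le_sum (f := fun j => PowerSeries.coeff n (F ^ m) c j) (fun _ _ => zero_le)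
    (Finset.mem_univ c)

lemma coeff_ne_top (hsub : ∀ i, ∑ j, evalSeries F 1 i j ≤ 1) (c : Fin k) (m n : ℕ) :
    PowerSeries.coeff n (F ^ m) c c ≠ ⊤ :=
  ((coeff_le_rowMass c m n).trans (rowMass_le_one hsub c m n)).trans_lt ENNReal.one_lt_top |>.ne

/-- Keeps only the paths that are back at `c` after `m` levels. It lets a long diagonal stretch be
followed by a short remainder. -/
lemma coeff_mul_rowMass_le (c : Fin k) (m m' n n' : ℕ) :
    PowerSeries.coeff n (F ^ m) c c * rowMass F c m' n' ≤ rowMass F c (m + m') (n + n') := by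
  unfold rowMass
  rw [Finset.mul_sum]
  refine Finset.sum_le_sum fun j _ => (mul_apply_le_mul_apply _ _ c c j).trans ?_
  rw [pow_add, PowerSeries.coeff_mul, Matrix.sum_apply]
  exact Finset.single_le_sum (f := fun x : ℕ × ℕ =>
    (PowerSeries.coeff x.1 (F ^ m) * PowerSeries.coeff x.2 (F ^ m')) c j) (fun _ _ => zero_le)
    (Finset.HasAntidiagonal.mem_antidiagonal.mpr (rfl : (n, n').1 + (n, n').2 = n + n'))

variable (F) in
/-- The diagonal coefficients of the powers of a matrix power series. -/
def diagCoeff (c : Fin k) (m n : ℕ) : ℝ := (PowerSeries.coeff n (F ^ m) c c).toReal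

lemma diagCoeff_nonneg (c : Fin k) (m n : ℕ) : 0 ≤ diagCoeff F c m n := ENNReal.toReal_nonneg

lemma diagCoeff_zero_zero (c : Fin k) : diagCoeff F c 0 0 = 1 := by simp [diagCoeff]

lemma ofReal_diagCoeff (hsub : ∀ i, ∑ j, evalSeries F 1 i j ≤ 1) (c : Fin k) (m n : ℕ) :
    ENNReal.ofReal (diagCoeff F c m n) = PowerSeries.coeff n (F ^ m) c c :=
  ENNReal.ofReal_toReal (coeff_ne_top hsub c m n)

lemma sum_diagCoeff_mul_le (hsub : ∀ i, ∑ j, evalSeries F 1 i j ≤ 1) (c : Fin k) (m m' n : ℕ) :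
    ∑ x ∈ Finset.HasAntidiagonal.antidiagonal n, diagCoeff F c m x.1 * diagCoeff F c m' x.2 ≤
      diagCoeff F c (m + m') n := by
  rw [← ENNReal.ofReal_le_ofReal_iff (diagCoeff_nonneg _ _ _), ofReal_diagCoeff hsub,
    ENNReal.ofReal_sum_of_nonneg fun x _ => mul_nonneg (diagCoeff_nonneg _ _ _)
      (diagCoeff_nonneg _ _ _), pow_add, PowerSeries.coeff_mul, Matrix.sum_apply]
  refine Finset.sum_le_sum fun x _ => ?_
  rw [ENNReal.ofReal_mul (diagCoeff_nonneg _ _ _), ofReal_diagCoeff hsub, ofReal_diagCoeff hsub]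
  exact mul_apply_le_mul_apply _ _ c c c

lemma ofReal_eval_truncPoly (hsub : ∀ i, ∑ j, evalSeries F 1 i j ≤ 1) (c : Fin k) (m L : ℕ)
    {z : ℝ} (hz : 0 ≤ z) : ENNReal.ofReal ((truncPoly (diagCoeff F c) m L).eval z) =
      ∑ n ∈ Finset.range (L + 1), ENNReal.ofReal z ^ n * PowerSeries.coeff n (F ^ m) c c := by
  rw [eval_truncPoly, ENNReal.ofReal_sum_of_nonneg fun n _ =>
    mul_nonneg (diagCoeff_nonneg _ _ _) (pow_nonneg hz n)]
  refine Finset.sum_congr rfl fun n _ => ?_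
  rw [ENNReal.ofReal_mul (diagCoeff_nonneg _ _ _), ofReal_diagCoeff hsub, ENNReal.ofReal_pow hz,
    mul_comm]

lemma eval_truncPoly_one_le (hsub : ∀ i, ∑ j, evalSeries F 1 i j ≤ 1) (c : Fin k) (m L : ℕ) :
    (truncPoly (diagCoeff F c) m L).eval 1 ≤ 1 := by
  rw [← ENNReal.ofReal_le_ofReal_iff zero_le_one, ofReal_eval_truncPoly hsub c m L zero_le_one,
    ENNReal.ofReal_one]
  simp only [one_pow, one_mul]
  exact (Finset.sum_le_sum fun n _ => coeff_le_rowMass c m n).trans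
    ((ENNReal.sum_le_tsum _).trans (tsum_rowMass_le_one hsub c m))

lemma evalSeries_pow_ne_zero
    (hirr : ∀ i j, ∃ m : ℕ, 0 < m ∧ ∃ n : ℕ, PowerSeries.coeff n (F ^ m) i j ≠ 0)
    {z : ℝ≥0∞} (hz : z ≠ 0) (i j : Fin k) : ∃ m > 0, (evalSeries F z ^ m) i j ≠ 0 := by
  obtain ⟨m, hm, n, hn⟩ := hirr i j
  refine ⟨m, hm, ?_⟩
  rw [← evalSeries_pow, evalSeries_apply]
  intro h
  exact mul_ne_zero (pow_ne_zero n hz) hn (ENNReal.tsum_eq_zero.mp h n)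

/-- If no diagonal entry of a power exceeded `exp (m r)`, irreducibility would bound the spectral
radius by `exp r`. A finite partial sum of the good entry already exceeds the bound, so truncation
costs nothing. -/
lemma exists_exp_lt_eval_truncPoly
    (hirr : ∀ i j, ∃ m : ℕ, 0 < m ∧ ∃ n : ℕ, PowerSeries.coeff n (F ^ m) i j ≠ 0)
    (hsub : ∀ i, ∑ j, evalSeries F 1 i j ≤ 1) (c : Fin k) {t r : ℝ}
    (h : (r : EReal) < logRadius F t) : ∃ m : ℕ, 0 < m ∧ ∃ L : ℕ,
      Real.exp (m * r) < (truncPoly (diagCoeff F c) m L).eval (Real.exp t) := by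
  set z := ENNReal.ofReal (Real.exp t) with hz
  have hz0 : z ≠ 0 := by simp [hz, Real.exp_pos]
  have hR : ENNReal.ofReal (Real.exp r) < extSpectralRadius (evalSeries F z) := by
    rw [← ENNReal.log_lt_log_iff, ENNReal.log_ofReal_of_pos (Real.exp_pos _), Real.log_exp]
    exact h
  have hdiag : ∃ m > 0, ENNReal.ofReal (Real.exp r) ^ m < (evalSeries F z ^ m) c c := by
    by_contra! hcon
    exact absurd (extSpectralRadius_le_of_diag_le (evalSeries_pow_ne_zero hirr hz0) c
      (by simp [Real.exp_pos]) ENNReal.ofReal_ne_top hcon) (not_le.mpr hR)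
  obtain ⟨m, hm, hlt⟩ := hdiag
  rw [← evalSeries_pow, evalSeries_apply, ENNReal.tsum_eq_iSup_nat, lt_iSup_iff] at hlt
  obtain ⟨L, hL⟩ := hlt
  refine ⟨m, hm, L, ?_⟩
  rw [← ENNReal.ofReal_lt_ofReal_iff_of_nonneg (Real.exp_pos _).le,
    ofReal_eval_truncPoly hsub c m L (Real.exp_pos _).le, Real.exp_nat_mul,
    ENNReal.ofReal_pow (Real.exp_pos _).le]
  refine hL.trans_le (Finset.sum_le_sum_of_subset ?_)
  exact Finset.range_mono (Nat.le_succ L)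

/-- A zero row in one power would stay zero in all higher powers, contradicting the returns to `c`
that irreducibility provides. -/
lemma exists_rowMass_ne_zero
    (hirr : ∀ i j, ∃ m : ℕ, 0 < m ∧ ∃ n : ℕ, PowerSeries.coeff n (F ^ m) i j ≠ 0) (c : Fin k) (r : ℕ) :
    ∃ n, rowMass F c r n ≠ 0 := by
  obtain ⟨m, hm, hne⟩ := evalSeries_pow_ne_zero hirr one_ne_zero c c
  have hpow : ∀ q : ℕ, (evalSeries F 1 ^ (m * q)) c c ≠ 0 := by
    intro q
    induction q with
    | zero => simp
    | succ q ih =>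
      rw [mul_add, mul_one, pow_add]
      intro h0
      have := mul_apply_le_mul_apply (evalSeries F 1 ^ (m * q)) (evalSeries F 1 ^ m) c c c
      rw [h0, nonpos_iff_eq_zero] at this
      exact mul_ne_zero ih hne this
  by_contra! hcon
  have hrow : ∀ j, (evalSeries F 1 ^ r) c j = 0 := by
    have h0 : ∑ j, (evalSeries F 1 ^ r) c j = 0 := by
      rw [← tsum_pow_mul_rowMass]
      simp [hcon]
    intro j
    exact Finset.sum_eq_zero_iff.mp h0 j (Finset.mem_univ j)
  have hle : r ≤ m * r := Nat.le_mul_of_pos_left r hm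
  refine hpow r ?_
  rw [← Nat.add_sub_of_le hle, pow_add, Matrix.mul_apply]
  simp [hrow]

lemma sum_rowMass_le_meanMass (c : Fin k) (m : ℕ) (Γ : Set ℝ) (s : Finset ℕ) (a : ℕ)
    (h : ∀ n ∈ s, (((n + a : ℕ) : ℝ) / m) ∈ Γ) :
    ∑ n ∈ s, rowMass F c m (n + a) ≤ meanMass F c m Γ := by
  classical
  have h1 : ∑ n ∈ s, rowMass F c m (n + a) = ∑ n ∈ s.image (· + a),
      if ((n : ℝ) / m) ∈ Γ then rowMass F c m n else 0 := by
    rw [Finset.sum_image fun x _ y _ hxy => Nat.add_right_cancel hxy]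
    exact Finset.sum_congr rfl fun n hn => by rw [if_pos (h n hn)]
  rw [h1, meanMass]
  convert ENNReal.sum_le_tsum (f := fun n : ℕ =>
    if ((n : ℝ) / m) ∈ Γ then rowMass F c m n else 0) (s.image (· + a)) using 4

/-- Local lower bound. -/
lemma eventually_exp_le_meanMass
    (hirr : ∀ i j, ∃ m : ℕ, 0 < m ∧ ∃ n : ℕ, PowerSeries.coeff n (F ^ m) i j ≠ 0)
    (hsub : ∀ i, ∑ j, evalSeries F 1 i j ≤ 1) (c : Fin k) {x : ℝ} {Γ : Set ℝ}
    (hx : x ∈ interior Γ) {a b : ℝ} (hab : a < b)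
    (hb : ∀ t : ℝ, ((b + t * x : ℝ) : EReal) < logRadius F t) :
    ∀ᶠ m : ℕ in atTop, ENNReal.ofReal (Real.exp (m * a)) ≤ meanMass F c m Γ := by
  obtain ⟨ε, hε, hball⟩ := Metric.isOpen_iff.mp isOpen_interior x hx
  -- Three errors are to be absorbed: the Cramér window, the gap between the tilted mean and `m₀ x`,
  -- and the remainder modulo `m₀`.
  set η := ε / 3 with hη
  have hη0 : 0 < η := by positivity
  obtain ⟨m₀, hm₀, L, t, y, hder, hgain, hmean⟩ := exists_tilt (diagCoeff_nonneg (F := F) c)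
    (diagCoeff_zero_zero c) (sum_diagCoeff_mul_le hsub c) (eval_truncPoly_one_le hsub c)
    (fun t => exists_exp_lt_eval_truncPoly hirr hsub c (hb t)) hη0
  have hm₀' : (0 : ℝ) < m₀ := by exact_mod_cast hm₀
  set p := truncPoly (diagCoeff F c) m₀ L with hp
  have hpos : 0 < p.eval (Real.exp t) :=
    pos_of_mul_pos_left ((Real.exp_pos _).trans hgain) (Real.exp_pos _).le
  -- The strict gain survives the cost `|t| η₂` of a narrow enough window.
  obtain ⟨η₂, ⟨hη₂, hη₂'⟩, hη₂0⟩ : ∃ η₂ : ℝ, (Real.exp (m₀ * b) <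
      p.eval (Real.exp t) * Real.exp (-(t * y) - |t| * η₂) ∧ η₂ < m₀ * η) ∧ 0 < η₂ := by
    have hc : Continuous fun η₂ : ℝ => p.eval (Real.exp t) * Real.exp (-(t * y) - |t| * η₂) := by
      fun_prop
    have h1 := (hc.tendsto 0).eventually (lt_mem_nhds (a := Real.exp (m₀ * b)) (by simpa using hgain))
    have h2 : ∀ᶠ s : ℝ in 𝓝 0, s < m₀ * η := gt_mem_nhds (by positivity)
    exact (((h1.and h2).filter_mono nhdsWithin_le_nhds).and
      (self_mem_nhdsWithin : ∀ᶠ s : ℝ in 𝓝[>] 0, s ∈ Set.Ioi 0)).exists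
  have hcramer := eventually_le_sum_coeff_pow (coeff_truncPoly_nonneg (diagCoeff_nonneg c) m₀ L)
    hpos hder hη₂0
  -- For each residue `r` modulo `m₀` an exponent of positive mass is fixed; `w` is the least of
  -- these finitely many masses. The slack `a < b` later absorbs `w` and the other constants.
  choose ν hν using exists_rowMass_ne_zero hirr c
  set w : ℝ≥0∞ := (Finset.range m₀).inf fun r => rowMass F c r (ν r) with hw
  have hw0 : 0 < w := by
    rw [hw, Finset.lt_inf_iff ENNReal.zero_lt_top]
    exact fun r _ => pos_iff_ne_zero.mpr (hν r)
  have hw1 : w ≠ ⊤ := ((Finset.inf_le (Finset.mem_range.mpr hm₀)).trans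
    (rowMass_le_one hsub c 0 (ν 0))).trans_lt ENNReal.one_lt_top |>.ne
  have hwr : 0 < w.toReal := ENNReal.toReal_pos hw0.ne' hw1
  have hl : Tendsto (fun m : ℕ => m / m₀) atTop atTop := Nat.tendsto_div_const_atTop hm₀.ne'
  have hlarge : ∀ᶠ m : ℕ in atTop,
      (∑ r ∈ Finset.range m₀, (ν r : ℝ)) + m₀ * |x| < m * η :=
    (tendsto_natCast_atTop_atTop.atTop_mul_const hη0).eventually_gt_atTop _
  have hsmall : ∀ᶠ m : ℕ in atTop,
      Real.exp (m * (a - b)) < w.toReal * (1 / 2) * Real.exp (-(m₀ * |b|)) := by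
    have h1 : Tendsto (fun m : ℕ => (m : ℝ) * (a - b)) atTop atBot :=
      tendsto_natCast_atTop_atTop.atTop_mul_const_of_neg (by linarith)
    exact (Real.tendsto_exp_atBot.comp h1).eventually_lt_const (by positivity)
  filter_upwards [hl.eventually hcramer, hlarge, hsmall, eventually_gt_atTop 0]
    with m hm1 hm2 hm3 hm0
  set l := m / m₀ with hldef
  set r := m % m₀ with hrdef
  have hr : r < m₀ := Nat.mod_lt _ hm₀
  have hm : m = m₀ * l + r := (Nat.div_add_mod m m₀).symm
  have hmR : (m : ℝ) = m₀ * l + r := by exact_mod_cast hm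
  have hm0' : (0 : ℝ) < m := by exact_mod_cast hm0
  have hrR : (r : ℝ) ≤ m₀ := by exact_mod_cast hr.le
  have hr0 : (0 : ℝ) ≤ r := Nat.cast_nonneg r
  set s := (p ^ l).support.filter fun n : ℕ => |(n : ℝ) - l * y| ≤ l * η₂ with hs
  have hmem : ∀ n ∈ s, (((n + ν r : ℕ) : ℝ) / m) ∈ Γ := by
    intro n hn
    have hn' : |(n : ℝ) - l * y| ≤ l * η₂ := (Finset.mem_filter.mp hn).2
    refine interior_subset (hball ?_)
    rw [Metric.mem_ball, Real.dist_eq, div_sub' hm0'.ne', abs_div, abs_of_pos hm0',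
      div_lt_iff₀ hm0']
    have hl0 : (0 : ℝ) ≤ l := Nat.cast_nonneg l
    have h1 : l * η₂ ≤ l * (m₀ * η) := mul_le_mul_of_nonneg_left hη₂'.le hl0
    have h2 : |l * y - l * (m₀ * x)| ≤ l * (m₀ * η) := by
      rw [← mul_sub, abs_mul, Nat.abs_cast]
      exact mul_le_mul_of_nonneg_left hmean hl0
    have h3 : (ν r : ℝ) ≤ ∑ r ∈ Finset.range m₀, (ν r : ℝ) :=
      Finset.single_le_sum (f := fun r => (ν r : ℝ)) (fun _ _ => Nat.cast_nonneg _)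
        (Finset.mem_range.mpr hr)
    have h4 : |r * x| ≤ m₀ * |x| := by
      rw [abs_mul, Nat.abs_cast]
      exact mul_le_mul_of_nonneg_right hrR (abs_nonneg x)
    have h5 : l * (m₀ * η) ≤ m * η := by
      rw [hmR]
      nlinarith
    have h6 : ((n + ν r : ℕ) : ℝ) - m * x =
        (n - l * y) + (l * y - l * (m₀ * x)) + (ν r - r * x) := by
      rw [hmR]
      push_cast
      ring
    have h7 : |(ν r : ℝ) - r * x| ≤ ν r + |r * x| := by
      have := abs_sub (ν r : ℝ) (r * x)
      rwa [Nat.abs_cast] at this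
    have h8 := abs_add_three ((n : ℝ) - l * y) (l * y - l * (m₀ * x)) (ν r - r * x)
    rw [h6]
    have h9 : ε * m = 3 * (m * η) := by rw [hη]; ring
    rw [h9]
    linarith
  calc ENNReal.ofReal (Real.exp (m * a))
      ≤ ENNReal.ofReal (∑ n ∈ s, (p ^ l).coeff n) * w := by
        rw [← ENNReal.ofReal_toReal hw1, ← ENNReal.ofReal_mul' hwr.le]
        refine ENNReal.ofReal_le_ofReal ?_
        have h1 : Real.exp (m₀ * b) ^ l ≤
            (p.eval (Real.exp t) * Real.exp (-(t * y) - |t| * η₂)) ^ l :=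
          pow_le_pow_left₀ (Real.exp_pos _).le hη₂.le l
        rw [← Real.exp_nat_mul] at h1
        have h2 : m * b - m₀ * |b| ≤ l * (m₀ * b) := by
          rw [hmR]
          nlinarith [le_abs_self b, abs_nonneg b]
        calc Real.exp (m * a) = Real.exp (m * (a - b)) * Real.exp (m * b) := by
              rw [← Real.exp_add]; ring_nf
          _ ≤ w.toReal * (1 / 2) * Real.exp (-(m₀ * |b|)) * Real.exp (m * b) :=
              mul_le_mul_of_nonneg_right hm3.le (Real.exp_pos _).le
          _ = w.toReal * (1 / 2) * Real.exp (m * b - m₀ * |b|) := by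
              rw [mul_assoc, ← Real.exp_add]; ring_nf
          _ ≤ w.toReal * (1 / 2) * Real.exp (l * (m₀ * b)) := by gcongr
          _ ≤ w.toReal * (1 / 2 *
              (p.eval (Real.exp t) * Real.exp (-(t * y) - |t| * η₂)) ^ l) := by
              rw [mul_assoc]; gcongr
          _ ≤ w.toReal * ∑ n ∈ s, (p ^ l).coeff n := mul_le_mul_of_nonneg_left hm1 hwr.le
          _ = _ := mul_comm _ _
    _ ≤ ∑ n ∈ s, PowerSeries.coeff n (F ^ (m₀ * l)) c c * rowMass F c r (ν r) := by
        rw [ENNReal.ofReal_sum_of_nonneg fun n _ =>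
          coeff_pow_nonneg (coeff_truncPoly_nonneg (diagCoeff_nonneg c) m₀ L) l n, Finset.sum_mul]
        refine Finset.sum_le_sum fun n _ => mul_le_mul' ?_
          (Finset.inf_le (f := fun r => rowMass F c r (ν r)) (Finset.mem_range.mpr hr))
        rw [← ofReal_diagCoeff hsub]
        exact ENNReal.ofReal_le_ofReal (coeff_truncPoly_pow_le (diagCoeff_nonneg c)
          (diagCoeff_zero_zero c) (sum_diagCoeff_mul_le hsub c) m₀ L l n)
    _ ≤ ∑ n ∈ s, rowMass F c m (n + ν r) := by
        refine Finset.sum_le_sum fun n _ => ?_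
        conv_rhs => rw [hm]
        exact coeff_mul_rowMass_le c _ _ _ _
    _ ≤ meanMass F c m Γ := sum_rowMass_le_meanMass c m Γ s (ν r) hmem

/-- Chernoff's bound. -/
lemma eventually_meanMass_halfSpace_le (c : Fin k) {t r : ℝ} (h : logRadius F t < r) (a : ℝ) :
    ∀ᶠ m : ℕ in atTop,
      meanMass F c m {y | a < t * y - r} ≤ ENNReal.ofReal (Real.exp (m * -a)) := by
  set z := ENNReal.ofReal (Real.exp t) with hz
  have hR : extSpectralRadius (evalSeries F z) < ENNReal.ofReal (Real.exp r) := by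
    rw [← ENNReal.log_lt_log_iff, ENNReal.log_ofReal_of_pos (Real.exp_pos _), Real.log_exp]
    exact h
  filter_upwards [eventually_rowSum_pow_le hR, eventually_gt_atTop 0] with m hm hm0
  have hm0' : (0 : ℝ) < m := by exact_mod_cast hm0
  calc meanMass F c m {y | a < t * y - r}
      ≤ ∑' n : ℕ, ENNReal.ofReal (Real.exp (-(m * (a + r)))) * (z ^ n * rowMass F c m n) := by
        refine ENNReal.tsum_le_tsum fun n => ?_
        split_ifs with hn
        · rw [← mul_assoc, hz, ← ENNReal.ofReal_pow (Real.exp_pos _).le,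
            ← ENNReal.ofReal_mul (Real.exp_pos _).le, ← Real.exp_nat_mul, ← Real.exp_add]
          refine le_mul_of_one_le_left' ?_
          rw [← ENNReal.ofReal_one]
          refine ENNReal.ofReal_le_ofReal (Real.one_le_exp ?_)
          have hn' : a < t * (n / m) - r := hn
          have h1 : m * (a + r) < m * (t * (n / m)) := mul_lt_mul_of_pos_left (by linarith) hm0'
          have h2 : m * (t * (n / m)) = n * t := by field_simp
          linarith
        · exact zero_le
    _ = ENNReal.ofReal (Real.exp (-(m * (a + r)))) * ∑ j, (evalSeries F z ^ m) c j := by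
        rw [ENNReal.tsum_mul_left, tsum_pow_mul_rowMass]
    _ ≤ ENNReal.ofReal (Real.exp (-(m * (a + r)))) * ENNReal.ofReal (Real.exp r) ^ m := by
        gcongr
        exact hm c
    _ = ENNReal.ofReal (Real.exp (m * -a)) := by
        rw [← ENNReal.ofReal_pow (Real.exp_pos _).le, ← ENNReal.ofReal_mul (Real.exp_pos _).le,
          ← Real.exp_nat_mul, ← Real.exp_add]
        ring_nf

/-- A union bound; only the nonnegative part of `Γ` needs covering, because the ratios `n / m` are
nonnegative. -/
lemma meanMass_le_sum {ι : Type*} (c : Fin k) (m : ℕ) (Γ : Set ℝ) (s : Finset ι) (U : ι → Set ℝ)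
    (h : Γ ∩ Set.Ici 0 ⊆ ⋃ i ∈ s, U i) : meanMass F c m Γ ≤ ∑ i ∈ s, meanMass F c m (U i) := by
  unfold meanMass
  rw [← Summable.tsum_finsetSum fun _ _ => ENNReal.summable]
  refine ENNReal.tsum_le_tsum fun n => ?_
  split_ifs with hn
  · obtain ⟨i, hi, hiU⟩ := Set.mem_iUnion₂.mp (h ⟨hn, by
      rw [Set.mem_Ici]; positivity⟩)
    refine le_trans ?_ (Finset.single_le_sum (fun _ _ => zero_le) hi)
    rw [if_pos hiU]
  · exact zero_le

/-- Upper bound. -/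
lemma eventually_meanMass_le (c : Fin k) (htail : ∃ t > 0, logRadius F t < ⊤) {Γ : Set ℝ}
    {a b : ℝ} (hab : a < b)
    (hb : ∀ x ∈ closure Γ, ∃ t : ℝ, (b : EReal) < ((t * x : ℝ) : EReal) - logRadius F t) :
    ∀ᶠ m : ℕ in atTop, meanMass F c m Γ ≤ ENNReal.ofReal (Real.exp (m * -a)) := by
  obtain ⟨t₀, ht₀, hlt⟩ := htail
  obtain ⟨r₀, hr₀, -⟩ := EReal.lt_iff_exists_real_btwn.mp hlt
  choose! τ hτ using hb
  have hb' : ∀ x ∈ closure Γ, ∃ r : ℝ, logRadius F (τ x) < r ∧ b < τ x * x - r :=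
    fun x hx => exists_real_lt_of_lt_sub (hτ x hx)
  choose! ρ hρ hρ' using hb'
  -- Each point of the closure has a half-space adapted to it; `none` is the half-line towards
  -- infinity given by the light tail. No tail bound on the left is needed.
  set U : Option ℝ → Set ℝ := fun o =>
    o.elim {y | b < t₀ * y - r₀} fun x => {y | b < τ x * y - ρ x} with hU
  have hcomp : IsCompact (closure Γ ∩ Set.Icc 0 ((b + r₀) / t₀)) :=
    isCompact_Icc.inter_left isClosed_closure
  obtain ⟨s, hs, hcover⟩ := hcomp.elim_nhds_subcover (fun x => {y | b < τ x * y - ρ x})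
    (fun x hx => IsOpen.mem_nhds (isOpen_lt continuous_const (by fun_prop)) (hρ' x hx.1))
  have hsub : Γ ∩ Set.Ici 0 ⊆ ⋃ i ∈ insert none (s.map Function.Embedding.some), U i := by
    rintro y ⟨hy, hy0⟩
    rcases le_or_gt y ((b + r₀) / t₀) with h | h
    · obtain ⟨x, hx, hxy⟩ := Set.mem_iUnion₂.mp (hcover ⟨subset_closure hy, hy0, h⟩)
      exact Set.mem_iUnion₂.mpr ⟨some x, by simpa using hx, hxy⟩
    · refine Set.mem_iUnion₂.mpr ⟨none, by simp, ?_⟩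
      rw [div_lt_iff₀ ht₀] at h
      show b < t₀ * y - r₀
      linarith
  have hall : ∀ᶠ m : ℕ in atTop, ∀ i ∈ insert none (s.map Function.Embedding.some),
      meanMass F c m (U i) ≤ ENNReal.ofReal (Real.exp (m * -b)) := by
    rw [Finset.eventually_all]
    intro i hi
    cases i with
    | none => exact eventually_meanMass_halfSpace_le c hr₀ b
    | some x =>
      have hx : x ∈ s := by simpa using hi
      exact eventually_meanMass_halfSpace_le c (hρ x (hs x hx).1) b
  -- The number of half-spaces is fixed, so it is absorbed by the slack `exp (m (b - a))`.
  set M := (insert none (s.map Function.Embedding.some)).card with hM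
  have hcard : ∀ᶠ m : ℕ in atTop, (M : ℝ) < Real.exp (m * (b - a)) :=
    (Real.tendsto_exp_atTop.comp
      (tendsto_natCast_atTop_atTop.atTop_mul_const (sub_pos.mpr hab))).eventually_gt_atTop _
  filter_upwards [hall, hcard] with m hm hm'
  refine (meanMass_le_sum c m Γ _ U hsub).trans ((Finset.sum_le_card_nsmul _ _ _ hm).trans ?_)
  rw [nsmul_eq_mul, ← ENNReal.ofReal_natCast, ← ENNReal.ofReal_mul (Nat.cast_nonneg _)]
  refine ENNReal.ofReal_le_ofReal ?_
  calc (M : ℝ) * Real.exp (m * -b) ≤ Real.exp (m * (b - a)) * Real.exp (m * -b) :=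
        mul_le_mul_of_nonneg_right hm'.le (Real.exp_pos _).le
    _ = Real.exp (m * -a) := by rw [← Real.exp_add]; ring_nf

end Series

/-! ### The rate function -/

section Rate

/-- The Fenchel-Legendre transform of an extended-real-valued function. -/
def legendre (Λ : ℝ → EReal) (x : ℝ) : EReal := ⨆ t : ℝ, ((t * x : ℝ) : EReal) - Λ t

/-- The epigraph is an intersection over `t` of half-planes, or of the empty set or the whole plane
where `Λ t` is infinite. -/
lemma isConvexFunction_legendre (Λ : ℝ → EReal) : IsConvexFunction (legendre Λ) := by
  unfold IsConvexFunction
  have h : {p : ℝ × ℝ | legendre Λ p.1 ≤ (p.2 : EReal)} =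
      ⋂ t : ℝ, {p : ℝ × ℝ | ((t * p.1 : ℝ) : EReal) - Λ t ≤ (p.2 : EReal)} := by
    ext p
    simp only [legendre, Set.mem_ofPred_eq, Set.mem_iInter, iSup_le_iff]
  rw [h]
  refine convex_iInter fun t => ?_
  generalize Λ t = b
  induction b with
  | bot =>
    have : {p : ℝ × ℝ | ((t * p.1 : ℝ) : EReal) - ⊥ ≤ (p.2 : EReal)} = ∅ := by
      ext p
      simp only [EReal.coe_sub_bot, Set.mem_ofPred_eq, Set.mem_empty_iff_false, iff_false, not_le]
      exact EReal.coe_lt_top _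
    rw [this]
    exact convex_empty
  | top =>
    have : {p : ℝ × ℝ | ((t * p.1 : ℝ) : EReal) - ⊤ ≤ (p.2 : EReal)} = Set.univ := by
      ext p
      simp only [EReal.sub_top, Set.mem_ofPred_eq, bot_le, Set.mem_univ]
    rw [this]
    exact convex_univ
  | coe b =>
    intro p hp q hq u v hu hv huv
    simp only [Set.mem_ofPred_eq, ← EReal.coe_sub, EReal.coe_le_coe_iff] at hp hq ⊢
    simp only [Prod.fst_add, Prod.snd_add, Prod.smul_fst, Prod.smul_snd, smul_eq_mul]
    have hb : b = u * b + v * b := by rw [← add_mul, huv, one_mul]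
    have h1 := mul_le_mul_of_nonneg_left hp hu
    have h2 := mul_le_mul_of_nonneg_left hq hv
    linarith

lemma lowerSemicontinuous_legendre (Λ : ℝ → EReal) : LowerSemicontinuous (legendre Λ) := by
  refine lowerSemicontinuous_iSup fun t => Continuous.lowerSemicontinuous ?_
  generalize Λ t = b
  induction b with
  | bot => simpa only [EReal.coe_sub_bot] using continuous_const
  | top => simpa only [EReal.sub_top] using continuous_const
  | coe b =>
    simp only [← EReal.coe_sub]
    exact continuous_coe_real_ereal.comp (by fun_prop)

lemma exists_real_mul_le_of_legendre_le {Λ : ℝ → EReal} {t : ℝ} (h : Λ t < ⊤) :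
    ∃ r : ℝ, ∀ x a : ℝ, legendre Λ x ≤ a → t * x ≤ a + r := by
  obtain ⟨r, hr, -⟩ := EReal.lt_iff_exists_real_btwn.mp h
  refine ⟨r, fun x a hx => ?_⟩
  have h1 : ((t * x : ℝ) : EReal) - Λ t ≤ a :=
    (le_iSup (fun t : ℝ => ((t * x : ℝ) : EReal) - Λ t) t).trans hx
  have h2 : ((t * x : ℝ) : EReal) - r ≤ a := (EReal.sub_le_sub le_rfl hr.le).trans h1
  rw [← EReal.coe_sub, EReal.coe_le_coe_iff] at h2
  linarith

/-- The term at `t = 0` gives nonnegativity. One `t` of each sign with `Λ t` below infinity bounds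
the sublevel sets from both sides. -/
lemma isGoodRateFunction_legendre {Λ : ℝ → EReal} (h0 : Λ 0 ≤ 0) (hneg : ∃ t < 0, Λ t < ⊤)
    (hpos : ∃ t > 0, Λ t < ⊤) : IsGoodRateFunction (legendre Λ) := by
  refine ⟨fun x => ?_, lowerSemicontinuous_legendre Λ, fun a => ?_⟩
  · refine le_trans ?_ (le_iSup (fun t : ℝ => ((t * x : ℝ) : EReal) - Λ t) 0)
    rw [zero_mul, EReal.coe_zero, zero_sub]
    exact EReal.neg_nonneg.mpr h0
  · obtain ⟨s, hs, hs'⟩ := hneg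
    obtain ⟨t, ht, ht'⟩ := hpos
    obtain ⟨q, hq⟩ := exists_real_mul_le_of_legendre_le hs'
    obtain ⟨r, hr⟩ := exists_real_mul_le_of_legendre_le ht'
    refine (isCompact_Icc (a := (a + q) / s) (b := (a + r) / t)).of_isClosed_subset
      ((lowerSemicontinuous_legendre Λ).isClosed_preimage a) fun x hx => ⟨?_, ?_⟩
    · rw [div_le_iff_of_neg hs, mul_comm]
      exact hq x a hx
    · rw [le_div_iff₀ ht, mul_comm]
      exact hr x a hx

end Rate

/-- The large deviation principle for the powers of an irreducible substochastic matrix power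
series with a light tail. -/
lemma satisfiesLDP_meanMass {k : ℕ} {F : PowerSeries (Matrix (Fin k) (Fin k) ℝ≥0∞)}
    (hirr : ∀ i j, ∃ m : ℕ, 0 < m ∧ ∃ n : ℕ, PowerSeries.coeff n (F ^ m) i j ≠ 0)
    (hsub : ∀ i, ∑ j, evalSeries F 1 i j ≤ 1) (htail : ∃ t > 0, logRadius F t < ⊤) (c : Fin k)
    {prob : ℕ → Set ℝ → ℝ≥0∞} (hprob : ∀ m > 0, ∀ Γ, prob m Γ = meanMass F c m Γ) :
    SatisfiesLDP prob (legendre (logRadius F)) := by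
  intro Γ
  refine ⟨?_, liminf_le_limsup, ?_⟩
  · rw [EReal.neg_le]
    refine le_iInf₂ fun x hx => ?_
    rw [EReal.neg_le]
    refine EReal.ge_of_forall_gt_iff_ge.mp fun a ha => ?_
    obtain ⟨b, hab, hb⟩ := EReal.lt_iff_exists_real_btwn.mp ha
    rw [EReal.coe_lt_coe_iff] at hab
    -- A transform below `-b` means that the line of slope `x` and height `b` lies strictly below
    -- `Λ`, which is the input of the local lower bound.
    have hb' : ∀ t : ℝ, ((b + t * x : ℝ) : EReal) < logRadius F t := by
      intro t
      have h1 : legendre (logRadius F) x < ((-b : ℝ) : EReal) := by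
        rw [EReal.coe_neg]
        exact EReal.lt_neg_comm.mp hb
      have h2 := (le_iSup (fun t : ℝ => ((t * x : ℝ) : EReal) - logRadius F t) t).trans_lt h1
      rw [ereal_sub_lt_coe_iff] at h2
      convert h2 using 2
      ring
    refine le_liminf_of_le (by isBoundedDefault) ?_
    filter_upwards [eventually_exp_le_meanMass hirr hsub c hx hab hb', eventually_gt_atTop 0]
      with m hm hm0
    exact coe_le_inv_mul_log hm0 (hm.trans_eq (hprob m hm0 Γ).symm)
  · rw [EReal.le_neg]
    refine EReal.ge_of_forall_gt_iff_ge.mp fun a ha => ?_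
    obtain ⟨b, hab, hb⟩ := EReal.lt_iff_exists_real_btwn.mp ha
    rw [EReal.coe_lt_coe_iff] at hab
    have hb' : ∀ x ∈ closure Γ, ∃ t : ℝ, (b : EReal) < ((t * x : ℝ) : EReal) - logRadius F t :=
      fun x hx => lt_iSup_iff.mp (hb.trans_le (iInf₂_le x hx))
    rw [EReal.le_neg, ← EReal.coe_neg]
    refine limsup_le_of_le (by isBoundedDefault) ?_
    filter_upwards [eventually_meanMass_le c htail hab hb', eventually_gt_atTop 0] with m hm hm0
    exact inv_mul_log_le_coe hm0 ((hprob m hm0 Γ).le.trans hm)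

/-! ### Substochastic matrices without eigenvalue one -/

section Substochastic

lemma mulVec_mono {σ : Type*} [Fintype σ] {A : Matrix σ σ ℝ} (hA : ∀ i j, 0 ≤ A i j)
    {u v : σ → ℝ} (h : ∀ i, u i ≤ v i) (i : σ) :
    (A.mulVec u) i ≤ (A.mulVec v) i :=
  Finset.sum_le_sum fun j _ => mul_le_mul_of_nonneg_left (h j) (hA i j)

lemma map_ofReal_mul {σ : Type*} [Fintype σ] {A B : Matrix σ σ ℝ}
    (hA : ∀ i j, 0 ≤ A i j) (hB : ∀ i j, 0 ≤ B i j) :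
    (A * B).map ENNReal.ofReal = A.map ENNReal.ofReal * B.map ENNReal.ofReal := by
  ext i j
  simp only [Matrix.map_apply, Matrix.mul_apply]
  rw [ENNReal.ofReal_sum_of_nonneg fun l _ => mul_nonneg (hA i l) (hB l j)]
  exact Finset.sum_congr rfl fun l _ => ENNReal.ofReal_mul (hA i l)

variable {σ : Type*} [Fintype σ] [DecidableEq σ] {A : Matrix σ σ ℝ}

/-- The row sums of `A ^ n` decrease, and their limit is a vector fixed by `A`; invertibility of `1
- A` makes it zero. -/
lemma tendsto_pow_mulVec_one (hA : ∀ i j, 0 ≤ A i j) (hrow : ∀ i, ∑ j, A i j ≤ 1)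
    (hunit : IsUnit (1 - A)) (i : σ) :
    Tendsto (fun n : ℕ => ((A ^ n).mulVec 1) i) atTop (𝓝 0) := by
  have hsucc : ∀ n : ℕ, (A ^ (n + 1)).mulVec 1 = A.mulVec ((A ^ n).mulVec 1) := fun n => by
    rw [pow_succ', Matrix.mulVec_mulVec]
  have hnn : ∀ (n : ℕ) i, 0 ≤ ((A ^ n).mulVec 1) i := by
    intro n i
    exact Finset.sum_nonneg fun j _ => mul_nonneg (Matrix.pow_apply_nonneg hA n i j) zero_le_one
  have hanti : ∀ (n : ℕ) i, ((A ^ (n + 1)).mulVec 1) i ≤ ((A ^ n).mulVec 1) i := by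
    intro n
    induction n with
    | zero =>
      intro i
      simpa [Matrix.mulVec, dotProduct, Matrix.one_apply] using hrow i
    | succ n ih =>
      intro i
      rw [hsucc (n + 1), hsucc n]
      refine mulVec_mono hA (fun j => ?_) i
      rw [← hsucc]
      exact ih j
  have hlim : ∀ i, ∃ u, Tendsto (fun n : ℕ => ((A ^ n).mulVec 1) i) atTop (𝓝 u) := fun i =>
    ⟨_, tendsto_atTop_ciInf (antitone_nat_of_succ_le fun n => hanti n i)
      ⟨0, by rintro _ ⟨n, rfl⟩; exact hnn n i⟩⟩
  choose u hu using hlim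
  have hfix : A.mulVec u = u := by
    ext i
    have h1 : Tendsto (fun n : ℕ => ((A ^ (n + 1)).mulVec 1) i) atTop (𝓝 ((A.mulVec u) i)) := by
      simp only [hsucc]
      exact tendsto_finsetSum _ fun j _ => (hu j).const_mul (A i j)
    exact tendsto_nhds_unique h1 ((hu i).comp (tendsto_add_atTop_nat 1))
  have hzero : u = 0 := by
    have h1 : (1 - A).mulVec u = 0 := by rw [Matrix.sub_mulVec, Matrix.one_mulVec, hfix, sub_self]
    obtain ⟨B, hB⟩ := hunit.exists_left_inv
    rw [← Matrix.one_mulVec u, ← hB, ← Matrix.mulVec_mulVec, h1, Matrix.mulVec_zero]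
  have := hu i
  rwa [hzero] at this

/-- Powers of a substochastic matrix without eigenvalue one decay geometrically. -/
lemma exists_pow_apply_le_geometric (hA : ∀ i j, 0 ≤ A i j) (hrow : ∀ i, ∑ j, A i j ≤ 1)
    (hunit : IsUnit (1 - A)) :
    ∃ θ : ℝ, 0 ≤ θ ∧ θ < 1 ∧ ∃ V : ℝ, 0 ≤ V ∧ ∀ (n : ℕ) (i j : σ), (A ^ n) i j ≤ V * θ ^ n := by
  obtain ⟨B, hB⟩ := hunit.exists_right_inv
  -- When `A` is the failure matrix, `v` plays the role of the expected number of codewords until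
  -- success. It serves as a weight under which `A` contracts.
  set v := B.mulVec 1 with hv
  have hfix : ∀ i, v i = 1 + (A.mulVec v) i := by
    intro i
    have h1 : (1 - A).mulVec v = 1 := by rw [hv, Matrix.mulVec_mulVec, hB, Matrix.one_mulVec]
    have h2 := congrFun h1 i
    rw [Matrix.sub_mulVec, Matrix.one_mulVec, Pi.sub_apply, Pi.one_apply] at h2
    linarith
  have hsucc : ∀ (n : ℕ) (w : σ → ℝ), (A ^ (n + 1)).mulVec w = (A ^ n).mulVec (A.mulVec w) :=
    fun n w => by rw [pow_succ, Matrix.mulVec_mulVec]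
  have hle : ∀ (n : ℕ) i, ((A ^ n).mulVec v) i ≤ v i := by
    intro n
    induction n with
    | zero => intro i; simp
    | succ n ih =>
      intro i
      rw [hsucc]
      exact (mulVec_mono (Matrix.pow_apply_nonneg hA n)
        (fun j => by linarith [hfix j]) i).trans (ih i)
  have hvan : ∀ i, Tendsto (fun n : ℕ => ((A ^ n).mulVec v) i) atTop (𝓝 0) := by
    intro i
    have h1 := (tendsto_pow_mulVec_one hA hrow hunit i).const_mul (∑ j, |v j|)
    rw [mul_zero] at h1
    refine squeeze_zero_norm (fun n => ?_) h1
    rw [Real.norm_eq_abs, Matrix.mulVec, dotProduct, Matrix.mulVec, dotProduct, Finset.mul_sum]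
    refine (Finset.abs_sum_le_sum_abs _ _).trans (Finset.sum_le_sum fun j _ => ?_)
    rw [abs_mul, abs_of_nonneg (Matrix.pow_apply_nonneg hA n i j), Pi.one_apply, mul_one, mul_comm]
    exact mul_le_mul_of_nonneg_right (Finset.single_le_sum (f := fun j => |v j|)
      (fun _ _ => abs_nonneg _) (Finset.mem_univ j)) (Matrix.pow_apply_nonneg hA n i j)
  -- Positivity is not assumed of the inverse: `A v = v - 1 ≤ v` makes `v` dominate all `A ^ n v`,
  -- which tend to zero.
  have hv0 : ∀ i, 0 ≤ v i := fun i => le_of_tendsto' (hvan i) fun n => hle n i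
  have hv1 : ∀ i, 1 ≤ v i := by
    intro i
    have h1 : 0 ≤ (A.mulVec v) i := Finset.sum_nonneg fun j _ => mul_nonneg (hA i j) (hv0 j)
    linarith [hfix i]
  set V := 1 + ∑ i, v i with hV
  have hV0 : 0 ≤ ∑ i, v i := Finset.sum_nonneg fun i _ => hv0 i
  have hvV : ∀ i, v i ≤ V := fun i => by
    have := Finset.single_le_sum (f := v) (fun i _ => hv0 i) (Finset.mem_univ i)
    linarith
  have hV1 : 1 ≤ V := by linarith
  have hVpos : 0 < V := by linarith
  have hinv1 : V⁻¹ ≤ 1 := inv_le_one_of_one_le₀ hV1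
  have hinv0 : 0 < V⁻¹ := inv_pos.mpr hVpos
  -- Since `1 ≤ v ≤ V`, subtracting one from `v` removes at least the fraction `1 / V` of it.
  have hcontr : ∀ i, (A.mulVec v) i ≤ (1 - V⁻¹) * v i := by
    intro i
    have h1 : V⁻¹ * v i ≤ 1 := by
      rw [inv_mul_le_iff₀ hVpos, mul_one]
      exact hvV i
    linarith [hfix i]
  have hpow : ∀ (n : ℕ) i, ((A ^ n).mulVec v) i ≤ (1 - V⁻¹) ^ n * v i := by
    intro n
    induction n with
    | zero => intro i; simp
    | succ n ih =>
      intro i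
      rw [hsucc]
      refine (mulVec_mono (v := (1 - V⁻¹) • v) (Matrix.pow_apply_nonneg hA n) hcontr i).trans ?_
      rw [Matrix.mulVec_smul, Pi.smul_apply, smul_eq_mul, pow_succ', mul_assoc]
      exact mul_le_mul_of_nonneg_left (ih i) (by linarith)
  refine ⟨1 - V⁻¹, by linarith, by linarith, V, hVpos.le, fun n i j => ?_⟩
  calc (A ^ n) i j ≤ (A ^ n) i j * v j :=
        le_mul_of_one_le_right (Matrix.pow_apply_nonneg hA n i j) (hv1 j)
    _ ≤ ((A ^ n).mulVec v) i := Finset.single_le_sum (f := fun j => (A ^ n) i j * v j)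
        (fun j _ => mul_nonneg (Matrix.pow_apply_nonneg hA n i j) (hv0 j)) (Finset.mem_univ j)
    _ ≤ (1 - V⁻¹) ^ n * v i := hpow n i
    _ ≤ V * (1 - V⁻¹) ^ n := by
        rw [mul_comm]
        exact mul_le_mul_of_nonneg_right (hvV i) (pow_nonneg (by linarith) n)

/-- A Neumann series argument: if all terms `A ^ n * M` vanished at `(i, j)`, iterating `W = M + A
W` would give `W i j = (A ^ n * W) i j`, which tends to zero. -/
lemma exists_pow_mul_apply_ne_zero (hA : ∀ i j, 0 ≤ A i j) (hrow : ∀ i, ∑ j, A i j ≤ 1)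
    (hunit : IsUnit (1 - A)) (M : Matrix σ σ ℝ) {i j : σ} (h : ((1 - A)⁻¹ * M) i j ≠ 0) :
    ∃ n : ℕ, (A ^ n * M) i j ≠ 0 := by
  by_contra! hcon
  set W := (1 - A)⁻¹ * M with hW
  have hfix : W = M + A * W := by
    have h1 : (1 - A) * W = M := by
      rw [hW, ← mul_assoc, Matrix.mul_nonsing_inv _ ((Matrix.isUnit_iff_isUnit_det _).mp hunit),
        one_mul]
    rw [sub_mul, one_mul] at h1
    rw [← h1]
    abel
  have hpow : ∀ n : ℕ, W i j = (A ^ n * W) i j := by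
    intro n
    induction n with
    | zero => simp
    | succ n ih =>
      rw [ih]
      conv_lhs => rw [hfix]
      rw [mul_add, Matrix.add_apply, hcon n, zero_add, ← mul_assoc, ← pow_succ]
  obtain ⟨θ, hθ0, hθ1, V, hV, hbound⟩ := exists_pow_apply_le_geometric hA hrow hunit
  have hentry : ∀ l, Tendsto (fun n : ℕ => (A ^ n) i l) atTop (𝓝 0) := by
    intro l
    have h1 := (tendsto_pow_atTop_nhds_zero_of_lt_one hθ0 hθ1).const_mul V
    rw [mul_zero] at h1
    exact squeeze_zero (fun n => Matrix.pow_apply_nonneg hA n i l) (fun n => hbound n i l) h1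
  have hlim : Tendsto (fun n : ℕ => (A ^ n * W) i j) atTop (𝓝 0) := by
    simp only [Matrix.mul_apply]
    have := tendsto_finsetSum Finset.univ fun l _ => (hentry l).mul_const (W l j)
    simpa using this
  simp only [← hpow] at hlim
  exact h (tendsto_nhds_unique tendsto_const_nhds hlim)

lemma map_ofReal_pow {A : Matrix σ σ ℝ} (hA : ∀ i j, 0 ≤ A i j) (n : ℕ) :
    (A ^ n).map ENNReal.ofReal = A.map ENNReal.ofReal ^ n := by
  induction n with
  | zero =>
    ext i j
    simp only [pow_zero, Matrix.map_apply, Matrix.one_apply]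
    split_ifs <;> simp
  | succ n ih => rw [pow_succ, map_ofReal_mul (Matrix.pow_apply_nonneg hA n) hA, ih, pow_succ]

/-- Nonvanishing of an entry of a power passes to matrices with larger support. -/
lemma pow_apply_ne_zero_of_support {A : Matrix σ σ ℝ} {B : Matrix σ σ ℝ≥0∞}
    (h : ∀ i j, A i j ≠ 0 → B i j ≠ 0) (m : ℕ) (i j : σ) (hm : (A ^ m) i j ≠ 0) :
    (B ^ m) i j ≠ 0 := by
  induction m generalizing j with
  | zero =>
    rw [pow_zero, Matrix.one_apply] at hm ⊢
    split_ifs at hm ⊢ <;> simp_all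
  | succ m ih =>
    rw [pow_succ, Matrix.mul_apply] at hm
    obtain ⟨l, -, hl⟩ := Finset.exists_ne_zero_of_sum_ne_zero hm
    rw [pow_succ]
    intro h0
    have h1 := mul_apply_le_mul_apply (B ^ m) B i l j
    rw [h0, nonpos_iff_eq_zero] at h1
    exact mul_ne_zero (ih l (left_ne_zero_of_mul hl)) (h l j (right_ne_zero_of_mul hl)) h1

end Substochastic

namespace ARQSystem

variable {k : ℕ} {ch : ErasureChannel k} {N K : ℕ} {Ω : Type*} [MeasurableSpace Ω]

/-! ### The sojourn series of an ARQ system -/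

lemma generatingMatrix_eq (S : ARQSystem ch N K Ω) (z : ℝ≥0∞) :
    S.generatingMatrix z = evalSeries S.sojournSeries z := by
  ext i j
  rw [generatingMatrix_apply, evalSeries_apply]

/-- The row sum is the probability that the sojourn time is finite. -/
lemma rowSum_evalSeries_le_one (S : ARQSystem ch N K Ω) (i : Fin k) :
    ∑ j, evalSeries S.sojournSeries 1 i j ≤ 1 := by
  have := S.isProbabilityMeasure i
  have h := tsum_pow_mul_rowMass S.sojournSeries i 1 1
  simp only [one_pow, one_mul, pow_one, rowMass] at h
  rw [← h]
  have h1 : ∀ n : ℕ, ∑ j, PowerSeries.coeff n S.sojournSeries i j =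
      S.P i {ω | S.hittingTime 1 0 ω = n} := fun n => by
    rw [measure_hittingTime_eq, pow_one]
  simp only [h1]
  rw [← measure_iUnion _ fun n => S.measurableSet_hittingTime_eq 1 0 n]
  · exact prob_le_one
  · intro n n' hne
    refine Set.disjoint_left.mpr fun ω hω hω' => hne ?_
    have h2 : S.hittingTime 1 0 ω = n := hω
    have h3 : S.hittingTime 1 0 ω = n' := hω'
    rw [h2] at h3
    exact_mod_cast h3

lemma blockWeight_rowSum_le_one (S : ARQSystem ch N K Ω) (d : Bool) (i : Fin k) :
    ∑ j, S.blockWeight d i j ≤ 1 := by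
  have := S.isProbabilityMeasure i
  exact (S.sum_measure_inter_state i {ω | S.D 0 ω = d} N).trans_le prob_le_one

lemma blockWeight_le_one (S : ARQSystem ch N K Ω) (d : Bool) (i j : Fin k) :
    S.blockWeight d i j ≤ 1 :=
  (Finset.single_le_sum (f := fun j => S.blockWeight d i j) (fun _ _ => zero_le)
    (Finset.mem_univ j)).trans (S.blockWeight_rowSum_le_one d i)

lemma blockWeight_ne_top (S : ARQSystem ch N K Ω) (d : Bool) (i j : Fin k) :
    S.blockWeight d i j ≠ ⊤ :=
  ((S.blockWeight_le_one d i j).trans_lt ENNReal.one_lt_top).ne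

lemma failureMatrix_nonneg (S : ARQSystem ch N K Ω) (i j : Fin k) : 0 ≤ S.failureMatrix i j := by
  rw [failureMatrix_apply]
  exact ENNReal.toReal_nonneg

lemma successMatrix_nonneg (S : ARQSystem ch N K Ω) (i j : Fin k) : 0 ≤ S.successMatrix i j := by
  rw [successMatrix_apply]
  exact ENNReal.toReal_nonneg

lemma failureMatrix_rowSum_le_one (S : ARQSystem ch N K Ω) (i : Fin k) :
    ∑ j, S.failureMatrix i j ≤ 1 := by
  simp only [failureMatrix_apply]
  rw [← ENNReal.toReal_sum fun j _ => S.blockWeight_ne_top false i j]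
  exact ENNReal.toReal_mono ENNReal.one_ne_top (S.blockWeight_rowSum_le_one false i)

lemma successMatrix_le_one (S : ARQSystem ch N K Ω) (i j : Fin k) : S.successMatrix i j ≤ 1 := by
  rw [successMatrix_apply]
  exact ENNReal.toReal_mono ENNReal.one_ne_top (S.blockWeight_le_one true i j)

lemma coeff_succ_sojournSeries (S : ARQSystem ch N K Ω) (n : ℕ) (i j : Fin k) :
    PowerSeries.coeff (n + 1) S.sojournSeries i j =
      ENNReal.ofReal ((S.failureMatrix ^ n * S.successMatrix) i j) := by
  have hK : S.failureMatrix.map ENNReal.ofReal = S.blockWeight false := by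
    ext i j
    rw [Matrix.map_apply, failureMatrix_apply, ENNReal.ofReal_toReal (S.blockWeight_ne_top _ _ _)]
  have hM : S.successMatrix.map ENNReal.ofReal = S.blockWeight true := by
    ext i j
    rw [Matrix.map_apply, successMatrix_apply, ENNReal.ofReal_toReal (S.blockWeight_ne_top _ _ _)]
  rw [sojournSeries, coeff_passageSeries_succ, ← hK, ← hM, ← map_ofReal_pow S.failureMatrix_nonneg,
    ← map_ofReal_mul (Matrix.pow_apply_nonneg S.failureMatrix_nonneg n) S.successMatrix_nonneg]
  rfl

/-- The inverse of a singular matrix is zero by convention, and the zero matrix is not irreducible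
in the sense of positive powers, even for one state. -/
lemma isUnit_one_sub_failureMatrix (S : ARQSystem ch N K Ω) (hk : 0 < k)
    (hG : ((1 - S.failureMatrix)⁻¹ * S.successMatrix).IsIrreducible) :
    IsUnit (1 - S.failureMatrix) := by
  by_contra hunit
  obtain ⟨m, hm, h⟩ := (Matrix.isIrreducible_iff_exists_pow_pos hG.nonneg).mp hG
    (⟨0, hk⟩ : Fin k) ⟨0, hk⟩
  rw [Matrix.isUnit_iff_isUnit_det] at hunit
  rw [Matrix.nonsing_inv_apply_not_isUnit _ hunit, zero_mul, zero_pow (by omega)] at h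
  exact lt_irrefl _ h

/-- The support of `(I - K)⁻¹ M` is contained in that of `G_T(1)`, so the irreducibility assumed for
the former passes to the sojourn series. -/
lemma exists_coeff_sojournSeries_pow_ne_zero (S : ARQSystem ch N K Ω) (hk : 0 < k)
    (hG : ((1 - S.failureMatrix)⁻¹ * S.successMatrix).IsIrreducible) (i j : Fin k) :
    ∃ m : ℕ, 0 < m ∧ ∃ n : ℕ, PowerSeries.coeff n (S.sojournSeries ^ m) i j ≠ 0 := by
  obtain ⟨m, hm, h⟩ := (Matrix.isIrreducible_iff_exists_pow_pos hG.nonneg).mp hG i j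
  have hsupp : ∀ i j, ((1 - S.failureMatrix)⁻¹ * S.successMatrix) i j ≠ 0 →
      evalSeries S.sojournSeries 1 i j ≠ 0 := by
    intro i j hij
    obtain ⟨n, hn⟩ := exists_pow_mul_apply_ne_zero S.failureMatrix_nonneg
      S.failureMatrix_rowSum_le_one (S.isUnit_one_sub_failureMatrix hk hG) S.successMatrix hij
    have hpos : 0 < (S.failureMatrix ^ n * S.successMatrix) i j := by
      refine lt_of_le_of_ne ?_ hn.symm
      rw [Matrix.mul_apply]
      exact Finset.sum_nonneg fun l _ => mul_nonneg
        (Matrix.pow_apply_nonneg S.failureMatrix_nonneg n i l) (S.successMatrix_nonneg l j)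
    intro h0
    have h1 := ENNReal.tsum_eq_zero.mp h0 (n + 1)
    rw [one_pow, one_mul, coeff_succ_sojournSeries, ENNReal.ofReal_eq_zero] at h1
    linarith
  have h2 := pow_apply_ne_zero_of_support hsupp m i j h.ne'
  rw [← evalSeries_pow, evalSeries_apply, ne_eq, ENNReal.tsum_eq_zero, not_forall] at h2
  obtain ⟨n, hn⟩ := h2
  exact ⟨m, hm, n, right_ne_zero_of_mul hn⟩

lemma exists_pos_logRadius_lt_top (S : ARQSystem ch N K Ω) (hk : 0 < k)
    (hG : ((1 - S.failureMatrix)⁻¹ * S.successMatrix).IsIrreducible) :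
    ∃ t > 0, logRadius S.sojournSeries t < ⊤ := by
  obtain ⟨θ, hθ0, hθ1, V, hV, hbound⟩ := exists_pow_apply_le_geometric S.failureMatrix_nonneg
    S.failureMatrix_rowSum_le_one (S.isUnit_one_sub_failureMatrix hk hG)
  -- A point with `z > 1` and `z θ < 1`: the tilt is positive and the geometric series still
  -- converges.
  set z : ℝ := 2 / (1 + θ) with hz
  have hz1 : 1 < z := by rw [hz, lt_div_iff₀ (by linarith)]; linarith
  have hz0 : 0 < z := by linarith
  have hzθ : z * θ < 1 := by rw [hz, div_mul_eq_mul_div, div_lt_one (by linarith)]; linarith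
  refine ⟨Real.log z, Real.log_pos hz1, ?_⟩
  rw [logRadius, Real.exp_log hz0, ENNReal.log_lt_top_iff, lt_top_iff_ne_top]
  refine extSpectralRadius_ne_top fun i j => ?_
  have hentry : ∀ n : ℕ, (S.failureMatrix ^ n * S.successMatrix) i j ≤ k * (V * θ ^ n) := by
    intro n
    rw [Matrix.mul_apply]
    refine (Finset.sum_le_sum fun l _ => ?_).trans_eq
      (by rw [Finset.sum_const, Finset.card_univ, Fintype.card_fin, nsmul_eq_mul])
    have h1 := mul_le_mul (hbound n i l) (S.successMatrix_le_one l j) (S.successMatrix_nonneg l j)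
      (mul_nonneg hV (pow_nonneg hθ0 n))
    rwa [mul_one] at h1
  rw [evalSeries_apply, tsum_eq_zero_add' ENNReal.summable]
  have h0 : PowerSeries.coeff 0 S.sojournSeries i j = 0 := by
    rw [sojournSeries, coeff_passageSeries_zero, Matrix.zero_apply]
  rw [h0, mul_zero, zero_add]
  have hle : ∀ n : ℕ, ENNReal.ofReal z ^ (n + 1) * PowerSeries.coeff (n + 1) S.sojournSeries i j ≤
      ENNReal.ofReal (z * (k * V)) * ENNReal.ofReal (z * θ) ^ n := by
    intro n
    rw [coeff_succ_sojournSeries, ← ENNReal.ofReal_pow hz0.le, ← ENNReal.ofReal_mul (by positivity),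
      ← ENNReal.ofReal_pow (by positivity), ← ENNReal.ofReal_mul (by positivity)]
    refine ENNReal.ofReal_le_ofReal ?_
    calc z ^ (n + 1) * (S.failureMatrix ^ n * S.successMatrix) i j
        ≤ z ^ (n + 1) * (k * (V * θ ^ n)) :=
          mul_le_mul_of_nonneg_left (hentry n) (by positivity)
      _ = z * (k * V) * (z * θ) ^ n := by ring
  refine ((ENNReal.tsum_le_tsum hle).trans_lt ?_).ne
  rw [ENNReal.tsum_mul_left, ENNReal.tsum_geometric]
  refine ENNReal.mul_lt_top ENNReal.ofReal_lt_top (ENNReal.inv_lt_top.mpr ?_)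
  rw [tsub_pos_iff_lt, ← ENNReal.ofReal_one]
  exact (ENNReal.ofReal_lt_ofReal_iff one_pos).mpr hzθ

/-- For `z ≤ 1` the generating matrix stays substochastic. This supplies both the value at zero and
finiteness from above on the negative side. -/
lemma logRadius_nonpos (S : ARQSystem ch N K Ω) {t : ℝ} (ht : t ≤ 0) :
    logRadius S.sojournSeries t ≤ 0 := by
  rw [logRadius, ENNReal.log_le_zero_iff]
  have hrow : ∀ i, ∑ j, evalSeries S.sojournSeries (ENNReal.ofReal (Real.exp t)) i j ≤ 1 := by
    intro i
    refine (Finset.sum_le_sum fun j _ => ?_).trans (S.rowSum_evalSeries_le_one i)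
    refine ENNReal.tsum_le_tsum fun n => mul_le_mul_left (pow_le_pow_left' ?_ n) _
    rw [← ENNReal.ofReal_one]
    exact ENNReal.ofReal_le_ofReal (Real.exp_le_one_iff.mpr ht)
  have hfin : ∀ i j, evalSeries S.sojournSeries (ENNReal.ofReal (Real.exp t)) i j ≠ ⊤ :=
    fun i j => ((Finset.single_le_sum
      (f := fun j => evalSeries S.sojournSeries (ENNReal.ofReal (Real.exp t)) i j)
      (fun _ _ => zero_le) (Finset.mem_univ j)).trans (hrow i)).trans_lt ENNReal.one_lt_top |>.ne
  have h := extSpectralRadius_pow_le hfin one_ne_zero (C := 1) (by simpa only [pow_one] using hrow)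
  rwa [pow_one] at h

lemma rateFunction_eq (S : ARQSystem ch N K Ω) :
    S.rateFunction = legendre (logRadius S.sojournSeries) := by
  ext x
  simp only [rateFunction, legendre, logRadius, generatingMatrix_eq]

end ARQSystem

end ErasureARQ

end

/-! ### The large deviation principle for the mean sojourn time -/

theorem theorem3 {k : ℕ} (hk : 0 < k) (ch : ErasureChannel k) (hch : ch.IsAdmissible)
    {N K : ℕ} (hN : 0 < N) (hK : K ≤ N)
    {Ω : Type*} [MeasurableSpace Ω] (S : ARQSystem ch N K Ω)
    (hG : ((1 - S.failureMatrix)⁻¹ * S.successMatrix).IsIrreducible) :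
    IsConvexFunction S.rateFunction
      ∧ IsGoodRateFunction S.rateFunction
      ∧ ∀ c : Fin k, SatisfiesLDP (fun m Γ => S.P c (S.meanEvent m Γ)) S.rateFunction := by
  rw [S.rateFunction_eq]
  have htail := S.exists_pos_logRadius_lt_top hk hG
  refine ⟨isConvexFunction_legendre _, isGoodRateFunction_legendre (S.logRadius_nonpos le_rfl)
    ⟨-1, by norm_num, (S.logRadius_nonpos (by norm_num)).trans_lt EReal.zero_lt_top⟩ htail,
    fun c => ?_⟩
  refine satisfiesLDP_meanMass (S.exists_coeff_sojournSeries_pow_ne_zero hk hG)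
    S.rowSum_evalSeries_le_one htail c fun m hm Γ => ?_
  exact S.measure_meanEvent c hm Γ
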